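/- Let $H$ be a complex Hilbert space, let $\mathcal B^{+}(H)$ be the set of positive bounded operators on $H$ and $\mathcal B^{+*}(H)$ the set of positive invertible ones; $\le$ is the Loewner order. For $A,B\in\mathcal B^{+*}(H)$ and $t\in[0,1]$ put $$A\nabla_tB=(1-t)A+tB,\qquad A!_tB=\big((1-t)A^{-1}+tB^{-1}\big)^{-1},\qquad A\sharp_tB=A^{1/2}\big(A^{-1/2}BA^{-1/2}\big)^tA^{1/2},$$ and let $L(A,B)=\big(\int_0^1A^{-1}!_tB^{-1}\,dt\big)^{-1}$ be the logarithmic operator mean. For $\lambda\in(0,1)$ let $\eta_\lambda$ be the probability measure on $[0,1]$ given by $d\eta_\lambda(t)=\frac{\lambda}{1-\lambda}\,t^{\frac{2\lambda-1}{1-\lambda}}\,dt$, and let $\eta_0=\delta_0$, $\eta_1=\delta_1$ be the Dirac masses at $0$ and $1$. For $\lambda\in[0,1]$, $A,B\in\mathcal B^{+*}(H)$ and $x>0$ put $$\mathbf L_\lambda(A,B)=\Big(\int_0^1(A\nabla_tB)^{-1}d\eta_\lambda(t)\Big)^{-1},\qquad \mathbb L_\lambda(A,B)=\int_0^1A\sharp_tB\,d\eta_\lambda(t),$$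 $$f_\lambda(x)=\Big(\int_0^1(1-t+tx)^{-1}d\eta_\lambda(t)\Big)^{-1},\qquad g_\lambda(x)=\int_0^1x^t\,d\eta_\lambda(t).$$ A Kubo–Ando mean on $H$ is a binary operation $\sigma$ on $\mathcal B^+(H)$ such that: $A\le C$ and $B\le D$ imply $A\sigma B\le C\sigma D$; $C(A\sigma B)C\le(CAC)\sigma(CBC)$ for all $A,B,C\in\mathcal B^+(H)$; $A_n\downarrow A$ and $B_n\downarrow B$ imply $A_n\sigma B_n\downarrow A\sigma B$, where $\downarrow$ means decreasing strong convergence of a sequence; and $I\sigma I=I$. A binary operation $M$ on $\mathcal B^{+*}(H)$ is an operator mean if it is the restriction of a Kubo–Ando mean. A function $f:(0,\infty)\to(0,\infty)$ is operator monotone (on $H$) if $f(A)\le f(B)$ for all self-adjoint $A\le B$ in $\mathcal B(H)$ with spectra in $(0,\infty)$. A representing function of $M$ is a continuous operator monotone function $f:(0,\infty)\to(0,\infty)$ with $f(1)=1$ and $M(A,B)=A^{1/2}f\big(A^{-1/2}BA^{-1/2}\big)A^{1/2}$ for all $A,B\in\mathcal B^{+*}(H)$. An operator mean is $\lambda$-weighted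 if it has a representing function $f$ that is differentiable at $1$ with $f'(1)=\lambda$. **Proposition.** For every $\lambda\in[0,1]$, the integrals defining $\mathbf L_\lambda(A,B)$ and $\mathbb L_\lambda(A,B)$ exist, and the first of them is invertible, for all $A,B\in\mathcal B^{+*}(H)$; $\mathbf L_\lambda$ and $\mathbb L_\lambda$ are $\lambda$-weighted operator means with representing functions $f_\lambda$ and $g_\lambda$ respectively; $f_\lambda$ and $g_\lambda$ are operator monotone on $(0,\infty)$, and $$f_\lambda(1)=g_\lambda(1)=1,\qquad f_\lambda'(1)=g_\lambda'(1)=\lambda.$$ Moreover, for all $A,B\in\mathcal B^{+*}(H)$, $$\mathbf L_{1/2}(A,B)=\mathbb L_{1/2}(A,B)=L(A,B).$$ -/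

import Mathlib

open MeasureTheory Filter Topology Set

namespace WeightedLogMean

/-- The probability measure `η_l` on `[0, 1]`, seen as a measure on `ℝ`. For `0 < l < 1` it has the
density `(l / (1 - l)) * t ^ ((2 * l - 1) / (1 - l))` with respect to Lebesgue measure on `[0, 1]`.
For `l = 0` and `l = 1` that formula does not define a probability measure, and `η_l` is the only
probability measure on `[0, 1]` with mean `l`, that is, the Dirac mass at `l` (which is also the
weak limit of the measures `η_s` as `s` tends to `l`). -/
noncomputable def eta (l : ℝ) : Measure ℝ :=
  if l = 0 then Measure.dirac 0
  else if l = 1 then Measure.dirac 1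
  else (volume.restrict (Icc (0 : ℝ) 1)).withDensity
    (fun t => ENNReal.ofReal (l / (1 - l) * t ^ ((2 * l - 1) / (1 - l))))

/-- `f_l(x) = (∫ (1 ∇_t x)⁻¹ dη_l(t))⁻¹`. -/
noncomputable def fRep (l x : ℝ) : ℝ :=
  (∫ t, ((1 - t) * 1 + t * x)⁻¹ ∂(eta l))⁻¹

/-- `g_l(x) = ∫ 1 ♯_t x dη_l(t)`, where `1 ♯_t x = x ^ t` for `x > 0`. -/
noncomputable def gRep (l x : ℝ) : ℝ :=
  ∫ t, x ^ t ∂(eta l)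

section Operators

variable {H : Type*} [NormedAddCommGroup H] [InnerProductSpace ℂ H] [CompleteSpace H]

/-- The weighted arithmetic mean `A ∇_t B`. -/
noncomputable def arith (t : ℝ) (A B : H →L[ℂ] H) : H →L[ℂ] H :=
  (1 - t) • A + t • B

/-- The weighted harmonic mean `A !_t B`, for `A` and `B` positive and invertible. -/
noncomputable def harm (t : ℝ) (A B : H →L[ℂ] H) : H →L[ℂ] H :=
  Ring.inverse ((1 - t) • Ring.inverse A + t • Ring.inverse B)

/-- The weighted geometric mean `A ♯_t B`, for `A` and `B` positive and invertible. -/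
noncomputable def geom (t : ℝ) (A B : H →L[ℂ] H) : H →L[ℂ] H :=
  A ^ (1 / 2 : ℝ) * (A ^ (-(1 / 2) : ℝ) * B * A ^ (-(1 / 2) : ℝ)) ^ t * A ^ (1 / 2 : ℝ)

/-- The logarithmic operator mean `L(A, B) = (∫₀¹ A⁻¹ !_t B⁻¹ dt)⁻¹`. -/
noncomputable def logMean (A B : H →L[ℂ] H) : H →L[ℂ] H :=
  Ring.inverse (∫ t in (0 : ℝ)..1, harm t (Ring.inverse A) (Ring.inverse B))

/-- `𝐋_l(A, B) = (∫ (A ∇_t B)⁻¹ dη_l(t))⁻¹`. -/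
noncomputable def boldL (l : ℝ) (A B : H →L[ℂ] H) : H →L[ℂ] H :=
  Ring.inverse (∫ t, Ring.inverse (arith t A B) ∂(eta l))

/-- `𝕃_l(A, B) = ∫ A ♯_t B dη_l(t)`. -/
noncomputable def bbL (l : ℝ) (A B : H →L[ℂ] H) : H →L[ℂ] H :=
  ∫ t, geom t A B ∂(eta l)

variable (H) in
/-- `f` is operator monotone on `I` (for operators on `H`): `f(A) ≤ f(B)` whenever `A ≤ B` are
self-adjoint operators on `H` with spectra in `I`. -/
def OperatorMonotoneOn (f : ℝ → ℝ) (I : Set ℝ) : Prop :=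
  ∀ A B : H →L[ℂ] H, IsSelfAdjoint A → IsSelfAdjoint B → spectrum ℝ A ⊆ I → spectrum ℝ B ⊆ I →
    A ≤ B → cfc f A ≤ cfc f B

/-- `S n ↓ T`: the sequence `S` is decreasing and converges strongly to `T`. -/
def DecreasesTo (S : ℕ → H →L[ℂ] H) (T : H →L[ℂ] H) : Prop :=
  Antitone S ∧ ∀ x : H, Tendsto (fun n => S n x) atTop (𝓝 (T x))

/-- The axioms of Kubo and Ando for an operator mean `σ`, a binary operation on the positive
operators on `H`. (Values of `σ` outside the positive operators play no role.) -/
structure IsKuboAndoMean (σ : (H →L[ℂ] H) → (H →L[ℂ] H) → (H →L[ℂ] H)) : Prop where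
  nonneg : ∀ A B : H →L[ℂ] H, 0 ≤ A → 0 ≤ B → 0 ≤ σ A B
  mono : ∀ A B C D : H →L[ℂ] H, 0 ≤ A → 0 ≤ B → A ≤ C → B ≤ D → σ A B ≤ σ C D
  transformer : ∀ A B C : H →L[ℂ] H, 0 ≤ A → 0 ≤ B → 0 ≤ C →
    C * σ A B * C ≤ σ (C * A * C) (C * B * C)
  continuous_above : ∀ (S T : ℕ → H →L[ℂ] H) (A B : H →L[ℂ] H),
    (∀ n, 0 ≤ S n) → (∀ n, 0 ≤ T n) → DecreasesTo S A → DecreasesTo T B →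
    DecreasesTo (fun n => σ (S n) (T n)) (σ A B)
  one_one : σ 1 1 = 1

/-- A binary operation `M` on the positive invertible operators is an operator mean if it is the
restriction of a Kubo-Ando mean (a mean on all positive operators, which is then determined by `M`
through continuity from above). -/
def IsOperatorMean (M : (H →L[ℂ] H) → (H →L[ℂ] H) → (H →L[ℂ] H)) : Prop :=
  ∃ σ : (H →L[ℂ] H) → (H →L[ℂ] H) → (H →L[ℂ] H), IsKuboAndoMean σ ∧
    ∀ A B : H →L[ℂ] H, IsStrictlyPositive A → IsStrictlyPositive B → M A B = σ A B

/-- `f` is the representing function of `M`: it is positive, continuous and operator monotone on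
`(0, ∞)`, `f(1) = 1`, and `M(A, B) = A^{1/2} f(A^{-1/2} B A^{-1/2}) A^{1/2}` for all positive
invertible `A` and `B`. -/
structure IsRepresentingFunction (M : (H →L[ℂ] H) → (H →L[ℂ] H) → (H →L[ℂ] H))
    (f : ℝ → ℝ) : Prop where
  pos : ∀ x : ℝ, 0 < x → 0 < f x
  continuousOn : ContinuousOn f (Ioi 0)
  operatorMonotone : OperatorMonotoneOn H f (Ioi 0)
  map_one : f 1 = 1
  apply_eq : ∀ A B : H →L[ℂ] H, IsStrictlyPositive A → IsStrictlyPositive B →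
    M A B = A ^ (1 / 2 : ℝ) * cfc f (A ^ (-(1 / 2) : ℝ) * B * A ^ (-(1 / 2) : ℝ)) *
      A ^ (1 / 2 : ℝ)

/-- `M` is an `l`-weighted operator mean: an operator mean whose representing function is
differentiable at `1` with derivative `l`. -/
def IsWeightedOperatorMean (l : ℝ) (M : (H →L[ℂ] H) → (H →L[ℂ] H) → (H →L[ℂ] H)) : Prop :=
  IsOperatorMean M ∧ ∃ f : ℝ → ℝ, IsRepresentingFunction M f ∧ HasDerivAt f l 1

end Operators

end WeightedLogMean

/-! Both families are perspectives `A^{1/2} f(A^{-1/2} B A^{-1/2}) A^{1/2}`, with `f` the inverted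
integral of the kernel `(1 - t + t x)⁻¹` (`harmFun μ`) or the integral of `x ^ t` (`powFun μ`). Only
two facts about `μ = η_l` matter for the weighted-mean part: it is a probability measure on `[0,
1]`, and its mean is `l`, which is the derivative of `f` at `1`.

A perspective is a Kubo–Ando mean as soon as `f` is positive, continuous and normalized, and both
`f` and its transpose `x f(1/x)` are operator monotone: the transpose exchanges the two arguments
(`perspective_swap`), hence joint monotonicity. Transposing `harmFun μ` or `powFun μ` only reflects
`μ` under `t ↦ 1 - t`, so both monotonicity conditions reduce to one: Löwner–Heinz for powers,
antitonicity of inversion for the harmonic kernel.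

The perspective extends to all positive operators as the decreasing strong limit of its values at `A
+ ε`, `B + ε`. Continuity from above rests on strong continuity of the functional calculus along
bounded sequences (`StrongTendsto.perspective`), and the transformer inequality on exact congruence
invariance for invertible `C` (`perspective_congruence`).

For `l = 1/2` the measure is Lebesgue measure, and both scalar functions equal `(x - 1) / log x`. -/

namespace WeightedLogMean

/-! ### Perspectives: congruence, transposition, joint monotonicity. -/

section Perspective

variable {H : Type*} [NormedAddCommGroup H] [InnerProductSpace ℂ H] [CompleteSpace H]

/-- The operator `A^{1/2} f(A^{-1/2} B A^{-1/2}) A^{1/2}`. -/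
noncomputable def perspective (f : ℝ → ℝ) (A B : H →L[ℂ] H) : H →L[ℂ] H :=
  A ^ (1 / 2 : ℝ) * cfc f (A ^ (-(1 / 2) : ℝ) * B * A ^ (-(1 / 2) : ℝ)) * A ^ (1 / 2 : ℝ)

theorem cfc_unitary_conj (f : ℝ → ℝ) {D U : H →L[ℂ] H} (hU : U ∈ unitary (H →L[ℂ] H))
    (hD : IsSelfAdjoint D) (hf : ContinuousOn f (spectrum ℝ D)) :
    cfc f (U * D * star U) = U * cfc f D * star U := by
  have h := StarAlgHomClass.map_cfc (R := ℝ) (S := ℂ)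
    (Unitary.conjStarAlgAut ℂ (H →L[ℂ] H) ⟨U, hU⟩) f D hf
    (by
      have : Continuous fun x : H →L[ℂ] H => U * x * star U := by fun_prop
      exact this) hD
    (by simpa using hD.conjugate U)
  simpa using h.symm

theorem rpow_half_mul_self {A : H →L[ℂ] H} (hA : IsStrictlyPositive A) :
    A ^ (1 / 2 : ℝ) * A ^ (1 / 2 : ℝ) = A := by
  rw [← CFC.rpow_add hA.isUnit]
  norm_num
  exact CFC.rpow_one A hA.nonneg

theorem rpow_neg_half_mul_self {A : H →L[ℂ] H} (hA : IsStrictlyPositive A) :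
    A ^ (-(1 / 2) : ℝ) * A ^ (-(1 / 2) : ℝ) = Ring.inverse A := by
  rw [← CFC.rpow_add hA.isUnit, CFC.inverse_eq_rpow_neg_one hA]
  norm_num

theorem rpow_half_mul_neg_half {A : H →L[ℂ] H} (hA : IsStrictlyPositive A) :
    A ^ (1 / 2 : ℝ) * A ^ (-(1 / 2) : ℝ) = 1 := CFC.rpow_mul_rpow_neg _ hA

theorem rpow_neg_half_mul_half {A : H →L[ℂ] H} (hA : IsStrictlyPositive A) :
    A ^ (-(1 / 2) : ℝ) * A ^ (1 / 2 : ℝ) = 1 := CFC.rpow_neg_mul_rpow _ hA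

theorem isSelfAdjoint_rpow (A : H →L[ℂ] H) (r : ℝ) : IsSelfAdjoint (A ^ r) :=
  .of_nonneg CFC.rpow_nonneg

theorem isStrictlyPositive_conj {B C : H →L[ℂ] H} (hB : IsStrictlyPositive B)
    (hC : IsStrictlyPositive C) : IsStrictlyPositive (C * B * C) :=
  ⟨conjugate_nonneg_of_nonneg hB.nonneg hC.nonneg, (hC.isUnit.mul hB.isUnit).mul hC.isUnit⟩

theorem isStrictlyPositive_conj_rpow_neg_half {A B : H →L[ℂ] H} (hA : IsStrictlyPositive A)
    (hB : IsStrictlyPositive B) :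
    IsStrictlyPositive (A ^ (-(1 / 2) : ℝ) * B * A ^ (-(1 / 2) : ℝ)) :=
  isStrictlyPositive_conj hB (hA.rpow A _)

theorem spectrum_subset_Ioi {A : H →L[ℂ] H} (hA : IsStrictlyPositive A) :
    spectrum ℝ A ⊆ Ioi 0 := fun _ hx => hA.spectrum_pos hx

theorem isStrictlyPositive_of_spectrum {A : H →L[ℂ] H} (hA : IsSelfAdjoint A)
    (h : spectrum ℝ A ⊆ Ioi 0) : IsStrictlyPositive A :=
  CStarAlgebra.isStrictlyPositive_iff_isSelfAdjoint_and_spectrum_pos.2 ⟨hA, fun _ hx => h hx⟩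

/-- In the formula for the perspective, `A^{1/2}` may be replaced by any `Y` with `Y Y* = A`. -/
theorem perspective_eq_of_mul_star {f : ℝ → ℝ} (hf : ContinuousOn f (Ioi 0))
    {A B Y Z : H →L[ℂ] H} (hA : IsStrictlyPositive A) (hB : IsStrictlyPositive B)
    (hY : Y * star Y = A) (hZY : Z * Y = 1) (hYZ : Y * Z = 1) :
    perspective f A B = Y * cfc f (Z * B * star Z) * star Y := by
  set P := A ^ (1 / 2 : ℝ) with hP
  set Q := A ^ (-(1 / 2) : ℝ) with hQ
  have hPs : star P = P := isSelfAdjoint_rpow A _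
  have hPQ : P * Q = 1 := rpow_half_mul_neg_half hA
  have hQP : Q * P = 1 := rpow_neg_half_mul_half hA
  have hPP : P * P = A := rpow_half_mul_self hA
  have hYZs : star Z * star Y = 1 := by rw [← star_mul, hYZ, star_one]
  have hZYs : star Y * star Z = 1 := by rw [← star_mul, hZY, star_one]
  -- Polar decomposition: with `U = Z * P` one has `Y = P * star U`, so the two expressions differ
  -- by a unitary conjugation inside the functional calculus.
  have hU : Z * P ∈ unitary (H →L[ℂ] H) := by
    rw [Unitary.mem_iff]
    have h2 : Z * P * star (Z * P) = 1 := by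
      calc Z * P * star (Z * P) = Z * (P * P) * star Z := by rw [star_mul, hPs]; noncomm_ring
        _ = (Z * Y) * (star Y * star Z) := by rw [hPP, ← hY]; noncomm_ring
        _ = 1 := by rw [hZY, hZYs, one_mul]
    refine ⟨?_, h2⟩
    -- In infinite dimension `h2` alone gives only a coisometry; the explicit left inverse `Q * Y`
    -- must then equal `star (Z * P)`.
    have h1 : (Q * Y) * (Z * P) = 1 := by
      calc (Q * Y) * (Z * P) = Q * (Y * Z) * P := by noncomm_ring
        _ = 1 := by rw [hYZ, mul_one, hQP]
    rwa [left_inv_eq_right_inv h1 h2] at h1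
  have hD := isStrictlyPositive_conj_rpow_neg_half hA hB
  have key := cfc_unitary_conj f hU hD.isSelfAdjoint (hf.mono (spectrum_subset_Ioi hD))
  rw [← hQ] at key
  have e1 : Z * P * (Q * B * Q) * star (Z * P) = Z * B * star Z := by
    calc Z * P * (Q * B * Q) * star (Z * P) = Z * (P * Q) * B * (Q * P) * star Z := by
          rw [star_mul, hPs]; noncomm_ring
      _ = _ := by rw [hPQ, hQP]; noncomm_ring
  rw [e1] at key
  rw [key, star_mul, hPs]
  symm
  calc Y * (Z * P * cfc f (Q * B * Q) * (P * star Z)) * star Y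
      = (Y * Z) * P * cfc f (Q * B * Q) * P * (star Z * star Y) := by noncomm_ring
    _ = P * cfc f (Q * B * Q) * P := by rw [hYZ, hYZs]; noncomm_ring

/-- `Y = C * A^{1/2}` satisfies `Y * star Y = C * A * C`, and with this root `C` cancels inside the
functional calculus. -/
theorem perspective_congruence {f : ℝ → ℝ} (hf : ContinuousOn f (Ioi 0))
    {A B C : H →L[ℂ] H} (hA : IsStrictlyPositive A) (hB : IsStrictlyPositive B)
    (hC : IsStrictlyPositive C) :
    perspective f (C * A * C) (C * B * C) = C * perspective f A B * C := by
  set P := A ^ (1 / 2 : ℝ) with hP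
  set Q := A ^ (-(1 / 2) : ℝ) with hQ
  have hPs : star P = P := isSelfAdjoint_rpow A _
  have hQs : star Q = Q := isSelfAdjoint_rpow A _
  have hPQ : P * Q = 1 := rpow_half_mul_neg_half hA
  have hQP : Q * P = 1 := rpow_neg_half_mul_half hA
  have hPP : P * P = A := rpow_half_mul_self hA
  have hCs : star C = C := hC.isSelfAdjoint
  set K := Ring.inverse C with hK
  have hKs : star K = K := hC.ringInverse.isSelfAdjoint
  have hKC : K * C = 1 := Ring.inverse_mul_cancel C hC.isUnit
  have hCK : C * K = 1 := Ring.mul_inverse_cancel C hC.isUnit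
  rw [perspective_eq_of_mul_star hf (Y := C * P) (Z := Q * K) (isStrictlyPositive_conj hA hC)
    (isStrictlyPositive_conj hB hC)]
  · have : Q * K * (C * B * C) * star (Q * K) = Q * B * Q := by
      calc Q * K * (C * B * C) * star (Q * K) = Q * (K * C) * B * (C * K) * Q := by
            rw [star_mul, hKs, hQs]; noncomm_ring
        _ = _ := by rw [hKC, hCK]; noncomm_ring
    rw [this, star_mul, hPs, hCs, perspective]
    noncomm_ring
  · rw [star_mul, hPs, hCs, ← hPP]; noncomm_ring
  · calc Q * K * (C * P) = Q * (K * C) * P := by noncomm_ring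
      _ = 1 := by rw [hKC, mul_one, hQP]
  · calc C * P * (Q * K) = C * (P * Q) * K := by noncomm_ring
      _ = 1 := by rw [hPQ, mul_one, hCK]

theorem perspective_one_left (f : ℝ → ℝ) (D : H →L[ℂ] H) : perspective f 1 D = cfc f D := by
  simp [perspective, CFC.one_rpow]

/-- The transpose `x ↦ x f(1/x)` of `f`. -/
noncomputable def transposeFun (f : ℝ → ℝ) (x : ℝ) : ℝ := x * f x⁻¹

theorem continuousOn_transposeFun {f : ℝ → ℝ} (hf : ContinuousOn f (Ioi 0)) :
    ContinuousOn (transposeFun f) (Ioi 0) :=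
  continuousOn_id.mul (hf.comp (continuousOn_inv₀.mono fun _ hx => ne_of_gt hx)
    fun x (hx : 0 < x) => mem_Ioi.2 (inv_pos.2 hx))

/-- Everything is a function of `D` alone: `x^{1/2} (x⁻¹ f(x)) x^{1/2} = f(x)`. -/
theorem perspective_transposeFun_one_right {f : ℝ → ℝ} (hf : ContinuousOn f (Ioi 0))
    {D : H →L[ℂ] H} (hD : IsStrictlyPositive D) :
    perspective (transposeFun f) D 1 = cfc f D := by
  have hsp := spectrum_subset_Ioi hD
  have hcr (r : ℝ) : ContinuousOn (fun x : ℝ => x ^ r) (spectrum ℝ D) := fun x hx =>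
    (Real.continuousAt_rpow_const x r (.inl (ne_of_gt (hsp hx)))).continuousWithinAt
  have hci : ContinuousOn (fun x : ℝ => x⁻¹) (spectrum ℝ D) :=
    continuousOn_inv₀.mono fun x hx => ne_of_gt (hsp hx)
  have e : D ^ (-(1 / 2) : ℝ) * 1 * D ^ (-(1 / 2) : ℝ) = cfc (fun x : ℝ => x⁻¹) D := by
    rw [mul_one, rpow_neg_half_mul_self hD, cfc_ringInverse_id D hD.isUnit hD.isSelfAdjoint]
  have hct : ContinuousOn (transposeFun f) ((fun x : ℝ => x⁻¹) '' spectrum ℝ D) :=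
    (continuousOn_transposeFun hf).mono (by
      rintro _ ⟨x, hx, rfl⟩
      exact mem_Ioi.2 (inv_pos.2 (mem_Ioi.1 (hsp hx))))
  have hct' : ContinuousOn (fun x => transposeFun f x⁻¹) (spectrum ℝ D) :=
    hct.comp hci (mapsTo_image _ _)
  rw [perspective, e, ← cfc_comp' (transposeFun f) (fun x : ℝ => x⁻¹) D hct hci hD.isSelfAdjoint,
    CFC.rpow_eq_cfc_real hD.nonneg, ← cfc_mul _ _ D (hcr _) hct',
    ← cfc_mul (fun x : ℝ => x ^ (1 / 2 : ℝ) * transposeFun f x⁻¹) _ D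
      ((hcr _).mul hct') (hcr _)]
  refine cfc_congr fun x hx => ?_
  have hx0 : 0 < x := hsp hx
  have : x ^ (1 / 2 : ℝ) * x ^ (1 / 2 : ℝ) = x := by
    rw [← Real.rpow_add hx0]; norm_num
  simp only [transposeFun, inv_inv]
  calc _ = (x ^ (1 / 2 : ℝ) * x ^ (1 / 2 : ℝ)) * x⁻¹ * f x := by ring
    _ = f x := by rw [this, mul_inv_cancel₀ hx0.ne', one_mul]

/-- Congruence by `A^{1/2}` carries the pair `(1, D)` to `(A, B)`, where `D = A^{-1/2} B A^{-1/2}`,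
so the case `A = 1` suffices. -/
theorem perspective_swap {f : ℝ → ℝ} (hf : ContinuousOn f (Ioi 0))
    {A B : H →L[ℂ] H} (hA : IsStrictlyPositive A) (hB : IsStrictlyPositive B) :
    perspective (transposeFun f) B A = perspective f A B := by
  have hC : IsStrictlyPositive (A ^ (1 / 2 : ℝ)) := hA.rpow A _
  have hD := isStrictlyPositive_conj_rpow_neg_half hA hB
  have h1 : A ^ (1 / 2 : ℝ) * 1 * A ^ (1 / 2 : ℝ) = A := by rw [mul_one, rpow_half_mul_self hA]
  have h2 : A ^ (1 / 2 : ℝ) * (A ^ (-(1 / 2) : ℝ) * B * A ^ (-(1 / 2) : ℝ)) * A ^ (1 / 2 : ℝ)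
      = B := by
    calc _ = (A ^ (1 / 2 : ℝ) * A ^ (-(1 / 2) : ℝ)) * B *
          (A ^ (-(1 / 2) : ℝ) * A ^ (1 / 2 : ℝ)) := by noncomm_ring
      _ = B := by rw [rpow_half_mul_neg_half hA, rpow_neg_half_mul_half hA, one_mul, mul_one]
  conv_lhs => rw [← h1, ← h2]
  rw [perspective_congruence (continuousOn_transposeFun hf) hD ⟨zero_le_one, isUnit_one⟩ hC,
    perspective_transposeFun_one_right hf hD, perspective]

theorem perspective_mono_right {f : ℝ → ℝ} (hm : OperatorMonotoneOn H f (Ioi 0))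
    {A B D : H →L[ℂ] H} (hA : IsStrictlyPositive A) (hB : IsStrictlyPositive B) (hBD : B ≤ D) :
    perspective f A B ≤ perspective f A D := by
  have hD := hB.of_le hBD
  have h1 := isStrictlyPositive_conj_rpow_neg_half hA hB
  have h2 := isStrictlyPositive_conj_rpow_neg_half hA hD
  exact conjugate_le_conjugate_of_nonneg
    (hm _ _ h1.isSelfAdjoint h2.isSelfAdjoint (spectrum_subset_Ioi h1) (spectrum_subset_Ioi h2)
      (conjugate_le_conjugate_of_nonneg hBD CFC.rpow_nonneg)) CFC.rpow_nonneg

theorem perspective_mono {f : ℝ → ℝ} (hf : ContinuousOn f (Ioi 0))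
    (hm : OperatorMonotoneOn H f (Ioi 0)) (ht : OperatorMonotoneOn H (transposeFun f) (Ioi 0))
    {A B C D : H →L[ℂ] H} (hA : IsStrictlyPositive A) (hB : IsStrictlyPositive B)
    (hAC : A ≤ C) (hBD : B ≤ D) : perspective f A B ≤ perspective f C D := by
  have hC := hA.of_le hAC
  have hD := hB.of_le hBD
  calc perspective f A B ≤ perspective f A D := perspective_mono_right hm hA hB hBD
    _ = perspective (transposeFun f) D A := (perspective_swap hf hA hD).symm
    _ ≤ perspective (transposeFun f) D C := perspective_mono_right ht hD hA hAC
    _ = perspective f C D := perspective_swap hf hC hD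

theorem perspective_nonneg {f : ℝ → ℝ} (hf : ∀ x, 0 < x → 0 < f x)
    {A B : H →L[ℂ] H} (hA : IsStrictlyPositive A) (hB : IsStrictlyPositive B) :
    0 ≤ perspective f A B :=
  conjugate_nonneg_of_nonneg (cfc_nonneg fun _ hx => (hf _ (spectrum_subset_Ioi
    (isStrictlyPositive_conj_rpow_neg_half hA hB) hx)).le) CFC.rpow_nonneg

end Perspective

/-! ### Strong convergence, monotone sequences and the functional calculus. -/

section StrongConvergence

variable {H : Type*} [NormedAddCommGroup H] [InnerProductSpace ℂ H]

/-- Strong convergence of a sequence of operators. -/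
def StrongTendsto (S : ℕ → H →L[ℂ] H) (T : H →L[ℂ] H) : Prop :=
  ∀ x : H, Tendsto (fun n => S n x) atTop (𝓝 (T x))

theorem StrongTendsto.of_tendsto {S : ℕ → H →L[ℂ] H} {T : H →L[ℂ] H}
    (h : Tendsto S atTop (𝓝 T)) : StrongTendsto S T := fun x =>
  ((ContinuousLinearMap.apply ℂ H x).continuous.tendsto T).comp h

theorem StrongTendsto.const (T : H →L[ℂ] H) : StrongTendsto (fun _ => T) T :=
  fun _ => tendsto_const_nhds

theorem StrongTendsto.add {S S' : ℕ → H →L[ℂ] H} {T T' : H →L[ℂ] H}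
    (h : StrongTendsto S T) (h' : StrongTendsto S' T') :
    StrongTendsto (fun n => S n + S' n) (T + T') := fun x => (h x).add (h' x)

theorem StrongTendsto.smul {S : ℕ → H →L[ℂ] H} {T : H →L[ℂ] H} (c : ℝ)
    (h : StrongTendsto S T) : StrongTendsto (fun n => c • S n) (c • T) :=
  fun x => (h x).const_smul c

theorem StrongTendsto.unique {S : ℕ → H →L[ℂ] H} {T T' : H →L[ℂ] H}
    (h : StrongTendsto S T) (h' : StrongTendsto S T') : T = T' :=
  ContinuousLinearMap.ext fun x => tendsto_nhds_unique (h x) (h' x)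

/-- Split `S n (S' n x) - T (T' x)` as `S n (S' n x - T' x) + (S n - T) (T' x)`; the uniform bound
on the left factors controls the first term. -/
theorem StrongTendsto.mul {S S' : ℕ → H →L[ℂ] H} {T T' : H →L[ℂ] H} {R : ℝ}
    (hR : ∀ n, ‖S n‖ ≤ R) (h : StrongTendsto S T) (h' : StrongTendsto S' T') :
    StrongTendsto (fun n => S n * S' n) (T * T') := by
  intro x
  have h1 : Tendsto (fun n => S n (S' n x - T' x)) atTop (𝓝 0) := by
    have h0 : Tendsto (fun n => R * ‖S' n x - T' x‖) atTop (𝓝 0) := by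
      have := (tendsto_iff_norm_sub_tendsto_zero.1 (h' x)).const_mul R
      rwa [mul_zero] at this
    exact squeeze_zero_norm (fun n => ((S n).le_opNorm _).trans
      (mul_le_mul_of_nonneg_right (hR n) (norm_nonneg _))) h0
  simpa using h1.add (h (T' x))

theorem StrongTendsto.le_of_forall_le {S : ℕ → H →L[ℂ] H} {T V : H →L[ℂ] H}
    (h : StrongTendsto S T) (hV : ∀ᶠ n in atTop, V ≤ S n) : V ≤ T := by
  rw [ContinuousLinearMap.le_def, ContinuousLinearMap.isPositive_iff_complex]
  intro x
  have hlim : Tendsto (fun n => inner ℂ ((S n - V) x) x) atTop (𝓝 (inner ℂ ((T - V) x) x)) :=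
    ((h x).sub_const (V x)).inner tendsto_const_nhds
  have hcl : IsClosed {z : ℂ | ((z.re : ℝ) : ℂ) = z ∧ 0 ≤ z.re} :=
    (isClosed_eq (by fun_prop) continuous_id).inter
      (isClosed_le continuous_const Complex.continuous_re)
  refine hcl.mem_of_tendsto hlim (hV.mono fun n hn => ?_)
  rw [ContinuousLinearMap.le_def, ContinuousLinearMap.isPositive_iff_complex] at hn
  exact hn x

theorem StrongTendsto.aeval {S : ℕ → H →L[ℂ] H} {T : H →L[ℂ] H} {R : ℝ}
    (hR : ∀ n, ‖S n‖ ≤ R) (h : StrongTendsto S T) (p : Polynomial ℝ) :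
    StrongTendsto (fun n => Polynomial.aeval (S n) p) (Polynomial.aeval T p) := by
  have hpow (k : ℕ) : StrongTendsto (fun n => S n ^ k) (T ^ k) := by
    induction k with
    | zero => simpa using StrongTendsto.const 1
    | succ k ih => simpa only [pow_succ'] using StrongTendsto.mul hR h ih
  induction p using Polynomial.induction_on' with
  | add p q hp hq => simpa using hp.add hq
  | monomial k c =>
    simpa [Polynomial.aeval_monomial, ← Algebra.smul_def] using (hpow k).smul c

variable [CompleteSpace H]

theorem StrongTendsto.ge_of_forall_ge {S : ℕ → H →L[ℂ] H} {T V : H →L[ℂ] H}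
    (h : StrongTendsto S T) (hV : ∀ᶠ n in atTop, S n ≤ V) : T ≤ V := by
  have := (h.smul (-1)).le_of_forall_le (V := -V) (by simpa using hV)
  simpa using this

theorem DecreasesTo.le {S : ℕ → H →L[ℂ] H} {T : H →L[ℂ] H} (h : DecreasesTo S T) (n : ℕ) :
    T ≤ S n :=
  StrongTendsto.ge_of_forall_ge h.2 ((eventually_ge_atTop n).mono fun _ hm => h.1 hm)

/-- Factor through `R = √T`: `‖T x‖ ≤ ‖R‖ ‖R x‖`, and `‖R x‖²` is the quadratic form. This upgrades
convergence of quadratic forms to strong convergence. -/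
theorem norm_apply_sq_le_of_nonneg {T : H →L[ℂ] H} (hT : 0 ≤ T) (x : H) :
    ‖T x‖ ^ 2 ≤ ‖T‖ * RCLike.re (inner ℂ (T x) x) := by
  set R := CFC.sqrt T with hR
  have hRR : R * R = T := CFC.sqrt_mul_sqrt_self T hT
  have hRs : IsSelfAdjoint R := .of_nonneg (CFC.sqrt_nonneg T)
  have hn : ‖T‖ = ‖R‖ * ‖R‖ := by
    rw [← CStarRing.norm_star_mul_self, hRs.star_eq, hRR]
  have hi : RCLike.re (inner ℂ (T x) x) = ‖R x‖ ^ 2 := by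
    rw [← hRR, mul_apply_eq_comp, ← ContinuousLinearMap.adjoint_inner_right,
      hRs.adjoint_eq, inner_self_eq_norm_sq]
  have hx : ‖T x‖ ≤ ‖R‖ * ‖R x‖ := by
    rw [← hRR]
    exact R.le_opNorm _
  calc ‖T x‖ ^ 2 ≤ (‖R‖ * ‖R x‖) ^ 2 := pow_le_pow_left₀ (norm_nonneg _) hx 2
    _ = _ := by rw [hn, hi]; ring

/-- A decreasing sequence of positive operators converges strongly. -/
theorem exists_decreasesTo {S : ℕ → H →L[ℂ] H} (hS : Antitone S) (h0 : ∀ n, 0 ≤ S n) :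
    ∃ T, DecreasesTo S T := by
  have hlim (x : H) : ∃ y, Tendsto (fun n => S n x) atTop (𝓝 y) := by
    set a : ℕ → ℝ := fun n => RCLike.re (inner ℂ (S n x) x) with ha
    have hanti : Antitone a := fun m n hmn => by
      have := (ContinuousLinearMap.le_def _ _).1 (hS hmn)
      simpa [ha, inner_sub_left] using this.re_inner_nonneg_left x
    have hbdd : BddBelow (range a) := ⟨0, by
      rintro _ ⟨n, rfl⟩
      exact ((ContinuousLinearMap.nonneg_iff_isPositive _).1 (h0 n)).re_inner_nonneg_left x⟩
    have hc : CauchySeq a := (tendsto_atTop_ciInf hanti hbdd).cauchySeq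
    -- The forms `a n` decrease and are bounded below, hence Cauchy; this estimate transfers the
    -- Cauchy property to `S n x`.
    have key (m n : ℕ) (hmn : m ≤ n) : ‖S m x - S n x‖ ^ 2 ≤ ‖S 0‖ * (a m - a n) := by
      have hle : 0 ≤ S m - S n := sub_nonneg.2 (hS hmn)
      have hnorm : ‖S m - S n‖ ≤ ‖S 0‖ := CStarAlgebra.norm_le_norm_of_nonneg_of_le hle
        ((sub_le_self _ (h0 n)).trans (hS (Nat.zero_le m)))
      have h1 := norm_apply_sq_le_of_nonneg hle x
      have h2 : RCLike.re (inner ℂ ((S m - S n) x) x) = a m - a n := by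
        simp [ha]
      rw [h2] at h1
      exact h1.trans (mul_le_mul_of_nonneg_right hnorm (sub_nonneg.2 (hanti hmn)))
    refine cauchySeq_tendsto_of_complete (Metric.cauchySeq_iff'.2 fun ε hε => ?_)
    obtain ⟨N, hN⟩ := Metric.cauchySeq_iff'.1 hc (ε ^ 2 / (‖S 0‖ + 1)) (by positivity)
    refine ⟨N, fun n hn => ?_⟩
    have h1 := key N n hn
    have h2 := hN n hn
    rw [Real.dist_eq, abs_sub_comm, abs_of_nonneg (sub_nonneg.2 (hanti hn)),
      lt_div_iff₀ (by positivity)] at h2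
    rw [dist_comm, dist_eq_norm]
    refine lt_of_pow_lt_pow_left₀ 2 hε.le ?_
    nlinarith [sub_nonneg.2 (hanti hn)]
  choose y hy using hlim
  refine ⟨continuousLinearMapOfTendsto S (f := y) (tendsto_pi_nhds.2 hy), hS, hy⟩

/-- The continuous functional calculus is strongly continuous along bounded sequences. -/
theorem StrongTendsto.cfc {S : ℕ → H →L[ℂ] H} {T : H →L[ℂ] H} {a b : ℝ} {f : ℝ → ℝ}
    (hf : ContinuousOn f (Icc a b)) (hS : ∀ n, IsSelfAdjoint (S n)) (hT : IsSelfAdjoint T)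
    (hSs : ∀ n, spectrum ℝ (S n) ⊆ Icc a b) (hTs : spectrum ℝ T ⊆ Icc a b)
    (h : StrongTendsto S T) :
    StrongTendsto (fun n => cfc f (S n)) (cfc f T) := by
  have hR (n : ℕ) : ‖S n‖ ≤ max |a| |b| := by
    rw [← cfc_id ℝ (S n) (hS n)]
    refine norm_cfc_le (by positivity) fun x hx => ?_
    exact abs_le_max_abs_abs (hSs n hx).1 (hSs n hx).2
  intro x
  rw [Metric.tendsto_atTop]
  intro ε hε
  -- Weierstrass: polynomials respect bounded strong limits, and replacing `f` by `p` costs less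
  -- than `ε / 3` at `x`, uniformly over operators with spectrum in `[a, b]`. The `+ 1` covers `x =
  -- 0`.
  obtain ⟨p, hp⟩ := exists_polynomial_near_of_continuousOn a b f hf (ε / (3 * (‖x‖ + 1)))
    (by positivity)
  have happ (A : H →L[ℂ] H) (hA : IsSelfAdjoint A) (hAs : spectrum ℝ A ⊆ Icc a b) :
      ‖_root_.cfc f A x - Polynomial.aeval A p x‖ < ε / 3 := by
    have h1 : ‖_root_.cfc f A - Polynomial.aeval A p‖ ≤ ε / (3 * (‖x‖ + 1)) := by
      rw [← cfc_polynomial p A hA, ← cfc_sub f p.eval A (hf.mono hAs) p.continuous.continuousOn]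
      refine norm_cfc_le (by positivity) fun y hy => ?_
      rw [Real.norm_eq_abs, abs_sub_comm]
      exact (hp y (hAs hy)).le
    have h2 := (_root_.cfc f A - Polynomial.aeval A p).le_of_opNorm_le h1 x
    rw [sub_apply] at h2
    refine h2.trans_lt ?_
    rw [div_mul_eq_mul_div, div_lt_div_iff₀ (by positivity) (by positivity)]
    nlinarith [norm_nonneg x]
  obtain ⟨N, hN⟩ := Metric.tendsto_atTop.1 (h.aeval hR p x) (ε / 3) (by positivity)
  refine ⟨N, fun n hn => ?_⟩
  have e1 := happ (S n) (hS n) (hSs n)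
  have e2 := happ T hT hTs
  have e3 := hN n hn
  rw [dist_eq_norm] at e3 ⊢
  rw [norm_sub_rev] at e2
  calc ‖_root_.cfc f (S n) x - _root_.cfc f T x‖
      = ‖(_root_.cfc f (S n) x - Polynomial.aeval (S n) p x) +
          (Polynomial.aeval (S n) p x - Polynomial.aeval T p x) +
          (Polynomial.aeval T p x - _root_.cfc f T x)‖ := by congr 1; abel
    _ ≤ _ := norm_add₃_le
    _ < ε := by linarith

theorem spectrum_subset_Icc_of_le {A : H →L[ℂ] H} {a b : ℝ} (hA : IsSelfAdjoint A)
    (ha : algebraMap ℝ (H →L[ℂ] H) a ≤ A) (hb : A ≤ algebraMap ℝ (H →L[ℂ] H) b) :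
    spectrum ℝ A ⊆ Icc a b := fun x hx =>
  ⟨(algebraMap_le_iff_le_spectrum hA).1 ha x hx, (le_algebraMap_iff_spectrum_le hA).1 hb x hx⟩

theorem isStrictlyPositive_of_algebraMap_le {A : H →L[ℂ] H} {a : ℝ} (h0 : 0 < a)
    (ha : algebraMap ℝ (H →L[ℂ] H) a ≤ A) : IsStrictlyPositive A :=
  (isStrictlyPositive_algebraMap h0).of_le ha

/-- Each factor is a functional calculus along a bounded sequence. Common positive scalar bounds
keep all spectra in one compact subset of `(0, ∞)`, so no control of `f` at `0` is needed. -/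
theorem StrongTendsto.perspective {f : ℝ → ℝ} (hf : ContinuousOn f (Ioi 0))
    {S T : ℕ → H →L[ℂ] H} {A B : H →L[ℂ] H} {a b : ℝ} (h0 : 0 < a) (hb : 0 < b)
    (hS : ∀ n, S n ∈ Icc (algebraMap ℝ (H →L[ℂ] H) a) (algebraMap ℝ (H →L[ℂ] H) b))
    (hT : ∀ n, T n ∈ Icc (algebraMap ℝ (H →L[ℂ] H) a) (algebraMap ℝ (H →L[ℂ] H) b))
    (hA : A ∈ Icc (algebraMap ℝ (H →L[ℂ] H) a) (algebraMap ℝ (H →L[ℂ] H) b))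
    (hB : B ∈ Icc (algebraMap ℝ (H →L[ℂ] H) a) (algebraMap ℝ (H →L[ℂ] H) b))
    (hSA : StrongTendsto S A) (hTB : StrongTendsto T B) :
    StrongTendsto (fun n => perspective f (S n) (T n)) (perspective f A B) := by
  have hpos {C : H →L[ℂ] H}
      (hC : C ∈ Icc (algebraMap ℝ (H →L[ℂ] H) a) (algebraMap ℝ (H →L[ℂ] H) b)) :
      IsStrictlyPositive C := isStrictlyPositive_of_algebraMap_le h0 hC.1
  have hsp {C : H →L[ℂ] H}
      (hC : C ∈ Icc (algebraMap ℝ (H →L[ℂ] H) a) (algebraMap ℝ (H →L[ℂ] H) b)) :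
      spectrum ℝ C ⊆ Icc a b := spectrum_subset_Icc_of_le (hpos hC).isSelfAdjoint hC.1 hC.2
  have hc (r : ℝ) : ContinuousOn (fun x : ℝ => x ^ r) (Icc a b) := fun x hx =>
    (Real.continuousAt_rpow_const x r (.inl (h0.trans_le hx.1).ne')).continuousWithinAt
  have hrpow (r : ℝ) : StrongTendsto (fun n => S n ^ r) (A ^ r) := by
    have := StrongTendsto.cfc (hc r) (fun n => (hpos (hS n)).isSelfAdjoint)
      (hpos hA).isSelfAdjoint (fun n => hsp (hS n)) (hsp hA) hSA
    simpa only [← CFC.rpow_eq_cfc_real (hpos hA).nonneg,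
      ← CFC.rpow_eq_cfc_real (hpos (hS _)).nonneg] using this
  have hbound (r : ℝ) : ∃ R, 0 ≤ R ∧ ∀ C ∈ Icc (algebraMap ℝ (H →L[ℂ] H) a)
      (algebraMap ℝ (H →L[ℂ] H) b), ‖C ^ r‖ ≤ R := by
    obtain ⟨R, hR⟩ := isCompact_Icc.exists_bound_of_continuousOn (hc r)
    refine ⟨max R 0, le_max_right _ _, fun C hC => ?_⟩
    rw [CFC.rpow_eq_cfc_real (hpos hC).nonneg]
    exact norm_cfc_le (le_max_right _ _) fun x hx => (hR x (hsp hC hx)).trans (le_max_left _ _)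
  obtain ⟨R, hR0, hR⟩ := hbound (1 / 2)
  obtain ⟨Q, hQ0, hQ⟩ := hbound (-(1 / 2))
  obtain ⟨W, hW0, hW⟩ := hbound 1
  have hW' (C : H →L[ℂ] H) (hC : C ∈ Icc (algebraMap ℝ (H →L[ℂ] H) a)
      (algebraMap ℝ (H →L[ℂ] H) b)) : ‖C‖ ≤ W := by
    simpa only [CFC.rpow_one C (hpos hC).nonneg] using hW C hC
  have hD : StrongTendsto (fun n => S n ^ (-(1 / 2) : ℝ) * T n * S n ^ (-(1 / 2) : ℝ))
      (A ^ (-(1 / 2) : ℝ) * B * A ^ (-(1 / 2) : ℝ)) := by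
    refine StrongTendsto.mul (R := Q * W) (fun n => ?_)
      (StrongTendsto.mul (fun n => hQ _ (hS n)) (hrpow _) hTB) (hrpow _)
    exact (norm_mul_le _ _).trans
      (mul_le_mul (hQ _ (hS n)) (hW' _ (hT n)) (norm_nonneg _) hQ0)
  have hinv {C : H →L[ℂ] H}
      (hC : C ∈ Icc (algebraMap ℝ (H →L[ℂ] H) a) (algebraMap ℝ (H →L[ℂ] H) b)) :
      algebraMap ℝ (H →L[ℂ] H) b⁻¹ ≤ C ^ (-(1 / 2) : ℝ) * C ^ (-(1 / 2) : ℝ) := by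
    rw [rpow_neg_half_mul_self (hpos hC), ← cfc_ringInverse_id (R := ℝ) C (hpos hC).isUnit
      (hpos hC).isSelfAdjoint]
    refine algebraMap_le_cfc _ _ C (fun x hx => ?_)
      (continuousOn_inv₀.mono fun x hx => (h0.trans_le (hsp hC hx).1).ne') (hpos hC).isSelfAdjoint
    exact inv_anti₀ (h0.trans_le (hsp hC hx).1) (hsp hC hx).2
  -- The lower bound comes from `D ≥ a` and `C⁻¹ ≥ b⁻¹`, the upper one from the norms.
  have hDsp {C D : H →L[ℂ] H}
      (hC : C ∈ Icc (algebraMap ℝ (H →L[ℂ] H) a) (algebraMap ℝ (H →L[ℂ] H) b))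
      (hD : D ∈ Icc (algebraMap ℝ (H →L[ℂ] H) a) (algebraMap ℝ (H →L[ℂ] H) b)) :
      spectrum ℝ (C ^ (-(1 / 2) : ℝ) * D * C ^ (-(1 / 2) : ℝ)) ⊆ Icc (a * b⁻¹) (Q * W * Q) := by
    have hp := isStrictlyPositive_conj_rpow_neg_half (hpos hC) (hpos hD)
    refine spectrum_subset_Icc_of_le hp.isSelfAdjoint ?_ ?_
    · calc algebraMap ℝ (H →L[ℂ] H) (a * b⁻¹) = a • algebraMap ℝ (H →L[ℂ] H) b⁻¹ := by
            rw [map_mul, Algebra.smul_def]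
        _ ≤ a • (C ^ (-(1 / 2) : ℝ) * C ^ (-(1 / 2) : ℝ)) :=
            smul_le_smul_of_nonneg_left (hinv hC) h0.le
        _ = C ^ (-(1 / 2) : ℝ) * algebraMap ℝ (H →L[ℂ] H) a * C ^ (-(1 / 2) : ℝ) := by
            rw [← Algebra.commutes, Algebra.smul_def, mul_assoc]
        _ ≤ _ := conjugate_le_conjugate_of_nonneg hD.1 CFC.rpow_nonneg
    · refine hp.isSelfAdjoint.le_algebraMap_norm_self.trans
        (algebraMap_mono (H →L[ℂ] H) ?_)
      refine (norm_mul_le _ _).trans (mul_le_mul ((norm_mul_le _ _).trans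
        (mul_le_mul (hQ _ hC) (hW' _ hD) (norm_nonneg _) hQ0)) (hQ _ hC) (norm_nonneg _)
        (by positivity))
  have hcfc := StrongTendsto.cfc (hf.mono fun x hx => (by positivity : 0 < a * b⁻¹).trans_le hx.1)
    (fun n => (isStrictlyPositive_conj_rpow_neg_half (hpos (hS n)) (hpos (hT n))).isSelfAdjoint)
    (isStrictlyPositive_conj_rpow_neg_half (hpos hA) (hpos hB)).isSelfAdjoint
    (fun n => hDsp (hS n) (hT n)) (hDsp hA hB) hD
  obtain ⟨K, hK⟩ := (isCompact_Icc (a := a * b⁻¹) (b := Q * W * Q)).exists_bound_of_continuousOn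
    (hf.mono fun x hx => (by positivity : 0 < a * b⁻¹).trans_le hx.1)
  refine StrongTendsto.mul (R := R * max K 0) (fun n => ?_)
    (StrongTendsto.mul (fun n => hR _ (hS n)) (hrpow _) hcfc) (hrpow _)
  refine (norm_mul_le _ _).trans (mul_le_mul (hR _ (hS n)) ?_ (norm_nonneg _) hR0)
  exact norm_cfc_le (le_max_right _ _) fun x hx =>
    (hK x (hDsp (hS n) (hT n) hx)).trans (le_max_left _ _)

end StrongConvergence

/-! ### From a generating function to a Kubo–Ando mean. -/

section KuboAndo

variable {H : Type*} [NormedAddCommGroup H] [InnerProductSpace ℂ H]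

theorem DecreasesTo.nonneg {S : ℕ → H →L[ℂ] H} {A : H →L[ℂ] H} (h : DecreasesTo S A)
    (h0 : ∀ n, 0 ≤ S n) : 0 ≤ A :=
  StrongTendsto.le_of_forall_le h.2 (.of_forall h0)

/-- The sequence `1 / (n + 1)` of positive scalar operators. -/
noncomputable def epsOp (H : Type*) [NormedAddCommGroup H] [InnerProductSpace ℂ H] (n : ℕ) :
    H →L[ℂ] H := algebraMap ℝ (H →L[ℂ] H) (1 / (n + 1))

theorem tendsto_epsOp : Tendsto (epsOp H) atTop (𝓝 0) := by
  have h := ((continuous_algebraMap ℝ (H →L[ℂ] H)).tendsto 0).comp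
    tendsto_one_div_add_atTop_nhds_zero_nat
  rwa [map_zero] at h

variable [CompleteSpace H]

theorem add_algebraMap_mem_Icc {A : H →L[ℂ] H} (hA : 0 ≤ A) {b r : ℝ} (hb : ‖A‖ ≤ b) :
    A + algebraMap ℝ (H →L[ℂ] H) r ∈
      Icc (algebraMap ℝ (H →L[ℂ] H) r) (algebraMap ℝ (H →L[ℂ] H) (b + r)) := by
  refine ⟨le_add_of_nonneg_left hA, ?_⟩
  rw [map_add]
  gcongr
  exact (IsSelfAdjoint.of_nonneg hA).le_algebraMap_norm_self.trans (algebraMap_mono _ hb)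

theorem DecreasesTo.norm_le {S : ℕ → H →L[ℂ] H} {A : H →L[ℂ] H} (h : DecreasesTo S A)
    (h0 : ∀ n, 0 ≤ S n) (n : ℕ) : ‖S n‖ ≤ ‖S 0‖ :=
  CStarAlgebra.norm_le_norm_of_nonneg_of_le (h0 n) (h.1 (Nat.zero_le n))

theorem DecreasesTo.norm_limit_le {S : ℕ → H →L[ℂ] H} {A : H →L[ℂ] H} (h : DecreasesTo S A)
    (h0 : ∀ n, 0 ≤ S n) : ‖A‖ ≤ ‖S 0‖ :=
  CStarAlgebra.norm_le_norm_of_nonneg_of_le (h.nonneg h0) (h.le 0)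

theorem DecreasesTo.perspective_add_algebraMap {f : ℝ → ℝ} (hf : ContinuousOn f (Ioi 0))
    {S T : ℕ → H →L[ℂ] H} {A B : H →L[ℂ] H} (hS0 : ∀ n, 0 ≤ S n) (hT0 : ∀ n, 0 ≤ T n)
    (hS : DecreasesTo S A) (hT : DecreasesTo T B) {r : ℝ} (hr : 0 < r) :
    StrongTendsto (fun n => perspective f (S n + algebraMap ℝ (H →L[ℂ] H) r)
        (T n + algebraMap ℝ (H →L[ℂ] H) r))
      (perspective f (A + algebraMap ℝ (H →L[ℂ] H) r) (B + algebraMap ℝ (H →L[ℂ] H) r)) := by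
  refine StrongTendsto.perspective hf hr (b := max ‖S 0‖ ‖T 0‖ + r) (by positivity)
    (fun n => ?_) (fun n => ?_) ?_ ?_ (StrongTendsto.add hS.2 (.const _))
    (StrongTendsto.add hT.2 (.const _))
  · exact add_algebraMap_mem_Icc (hS0 n) ((hS.norm_le hS0 n).trans (le_max_left _ _))
  · exact add_algebraMap_mem_Icc (hT0 n) ((hT.norm_le hT0 n).trans (le_max_right _ _))
  · exact add_algebraMap_mem_Icc (hS.nonneg hS0) ((hS.norm_limit_le hS0).trans (le_max_left _ _))
  · exact add_algebraMap_mem_Icc (hT.nonneg hT0) ((hT.norm_limit_le hT0).trans (le_max_right _ _))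

theorem antitone_epsOp : Antitone (epsOp H) := fun _ _ h =>
  algebraMap_mono _ (Nat.one_div_le_one_div h)

theorem isStrictlyPositive_epsOp (n : ℕ) : IsStrictlyPositive (epsOp H n) :=
  isStrictlyPositive_algebraMap Nat.one_div_pos_of_nat

theorem isStrictlyPositive_add_epsOp {A : H →L[ℂ] H} (hA : 0 ≤ A) (n : ℕ) :
    IsStrictlyPositive (A + epsOp H n) :=
  (isStrictlyPositive_epsOp n).nonneg_add hA

theorem decreasesTo_add_epsOp (A : H →L[ℂ] H) : DecreasesTo (fun n => A + epsOp H n) A := by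
  refine ⟨fun _ _ h => add_le_add_right (antitone_epsOp h) A, StrongTendsto.of_tendsto ?_⟩
  simpa using tendsto_epsOp.const_add A

/-- The hypotheses under which the perspective of `f` is an operator mean. -/
structure IsMeanGenerator (H : Type*) [NormedAddCommGroup H] [InnerProductSpace ℂ H]
    [CompleteSpace H] (f : ℝ → ℝ) : Prop where
  pos : ∀ x : ℝ, 0 < x → 0 < f x
  continuousOn : ContinuousOn f (Ioi 0)
  monotone : OperatorMonotoneOn H f (Ioi 0)
  transpose_monotone : OperatorMonotoneOn H (transposeFun f) (Ioi 0)
  map_one : f 1 = 1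

open Classical in
/-- The extension of the perspective of `f` to positive operators, as the strong limit of its
values at `A + 1 / (n + 1)` and `B + 1 / (n + 1)`. -/
noncomputable def perspectiveExt (f : ℝ → ℝ) (A B : H →L[ℂ] H) : H →L[ℂ] H :=
  if h : ∃ T, DecreasesTo (fun n => perspective f (A + epsOp H n) (B + epsOp H n)) T then h.choose
  else 0

variable {f : ℝ → ℝ}

theorem IsMeanGenerator.decreasesTo_perspectiveExt (hf : IsMeanGenerator H f) {A B : H →L[ℂ] H}
    (hA : 0 ≤ A) (hB : 0 ≤ B) :
    DecreasesTo (fun n => perspective f (A + epsOp H n) (B + epsOp H n))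
      (perspectiveExt f A B) := by
  have h : ∃ T, DecreasesTo (fun n => perspective f (A + epsOp H n) (B + epsOp H n)) T := by
    refine exists_decreasesTo (fun m n hmn => ?_) fun n => perspective_nonneg hf.pos
      (isStrictlyPositive_add_epsOp hA n) (isStrictlyPositive_add_epsOp hB n)
    exact perspective_mono hf.continuousOn hf.monotone hf.transpose_monotone
      (isStrictlyPositive_add_epsOp hA n) (isStrictlyPositive_add_epsOp hB n)
      (add_le_add_right (antitone_epsOp hmn) A) (add_le_add_right (antitone_epsOp hmn) B)
  rw [perspectiveExt, dif_pos h]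
  exact h.choose_spec

/-- `A`, `B` and their perturbations all lie between two fixed positive scalars, so strong
continuity identifies the limit. -/
theorem IsMeanGenerator.perspectiveExt_eq (hf : IsMeanGenerator H f) {A B : H →L[ℂ] H}
    (hA : IsStrictlyPositive A) (hB : IsStrictlyPositive B) :
    perspectiveExt f A B = perspective f A B := by
  rcases subsingleton_or_nontrivial (H →L[ℂ] H) with _ | _
  · exact Subsingleton.elim _ _
  refine StrongTendsto.unique (hf.decreasesTo_perspectiveExt hA.nonneg hB.nonneg).2 ?_
  obtain ⟨r, hr, hrA⟩ := (CFC.exists_pos_algebraMap_le_iff hA.isSelfAdjoint).2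
    fun x hx => hA.spectrum_pos hx
  obtain ⟨s, hs, hsB⟩ := (CFC.exists_pos_algebraMap_le_iff hB.isSelfAdjoint).2
    fun x hx => hB.spectrum_pos hx
  have hlow {C : H →L[ℂ] H} {q : ℝ} (hC : algebraMap ℝ (H →L[ℂ] H) q ≤ C)
      (hq : min r s ≤ q) : algebraMap ℝ (H →L[ℂ] H) (min r s) ≤ C :=
    (algebraMap_mono _ hq).trans hC
  have hup {C : H →L[ℂ] H} (hC : 0 ≤ C) (h : ‖C‖ ≤ max ‖A‖ ‖B‖) (n : ℕ) :
      C + epsOp H n ≤ algebraMap ℝ (H →L[ℂ] H) (max ‖A‖ ‖B‖ + 1) :=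
    (add_algebraMap_mem_Icc hC h).2.trans (algebraMap_mono _ (by
      gcongr
      exact Nat.one_div_le_one_div (Nat.zero_le n) |>.trans_eq (by simp)))
  have heps (C : H →L[ℂ] H) (n : ℕ) : C ≤ C + epsOp H n :=
    le_add_of_nonneg_right (isStrictlyPositive_epsOp n).nonneg
  exact StrongTendsto.perspective hf.continuousOn (lt_min hr hs) (b := max ‖A‖ ‖B‖ + 1)
    (by positivity)
    (fun n => ⟨(hlow hrA (min_le_left _ _)).trans (heps A n), hup hA.nonneg (le_max_left _ _) n⟩)
    (fun n => ⟨(hlow hsB (min_le_right _ _)).trans (heps B n), hup hB.nonneg (le_max_right _ _) n⟩)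
    ⟨hlow hrA (min_le_left _ _), (heps A 0).trans (hup hA.nonneg (le_max_left _ _) 0)⟩
    ⟨hlow hsB (min_le_right _ _), (heps B 0).trans (hup hB.nonneg (le_max_right _ _) 0)⟩
    (decreasesTo_add_epsOp A).2 (decreasesTo_add_epsOp B).2

theorem IsMeanGenerator.perspectiveExt_mono (hf : IsMeanGenerator H f) {A B C D : H →L[ℂ] H}
    (hA : 0 ≤ A) (hB : 0 ≤ B) (hAC : A ≤ C) (hBD : B ≤ D) :
    perspectiveExt f A B ≤ perspectiveExt f C D := by
  refine StrongTendsto.le_of_forall_le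
    (hf.decreasesTo_perspectiveExt (hA.trans hAC) (hB.trans hBD)).2 (.of_forall fun n => ?_)
  exact ((hf.decreasesTo_perspectiveExt hA hB).le n).trans
    (perspective_mono hf.continuousOn hf.monotone hf.transpose_monotone
      (isStrictlyPositive_add_epsOp hA n) (isStrictlyPositive_add_epsOp hB n)
      (add_le_add_left hAC _) (add_le_add_left hBD _))

theorem IsMeanGenerator.perspectiveExt_nonneg (hf : IsMeanGenerator H f) {A B : H →L[ℂ] H}
    (hA : 0 ≤ A) (hB : 0 ≤ B) : 0 ≤ perspectiveExt f A B :=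
  (hf.decreasesTo_perspectiveExt hA hB).nonneg fun n => perspective_nonneg hf.pos
    (isStrictlyPositive_add_epsOp hA n) (isStrictlyPositive_add_epsOp hB n)

theorem IsMeanGenerator.decreasesTo_of_decreasesTo (hf : IsMeanGenerator H f)
    {S T : ℕ → H →L[ℂ] H} {A B : H →L[ℂ] H} (hS0 : ∀ n, 0 ≤ S n) (hT0 : ∀ n, 0 ≤ T n)
    (hS : DecreasesTo S A) (hT : DecreasesTo T B) :
    DecreasesTo (fun n => perspectiveExt f (S n) (T n)) (perspectiveExt f A B) := by
  have hA := hS.nonneg hS0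
  have hB := hT.nonneg hT0
  obtain ⟨W, hW⟩ := exists_decreasesTo (S := fun n => perspectiveExt f (S n) (T n))
    (fun m n hmn => hf.perspectiveExt_mono (hS0 n) (hT0 n) (hS.1 hmn) (hT.1 hmn))
    (fun n => hf.perspectiveExt_nonneg (hS0 n) (hT0 n))
  have h1 : perspectiveExt f A B ≤ W := StrongTendsto.le_of_forall_le hW.2
    (.of_forall fun n => hf.perspectiveExt_mono hA hB (hS.le n) (hT.le n))
  -- Two limits are interchanged: for a fixed shift `k`, `W` lies below the shifted perspectives of
  -- `S n`, `T n`; let `n` tend to infinity, then `k`.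
  have h2 : W ≤ perspectiveExt f A B := by
    refine StrongTendsto.le_of_forall_le (hf.decreasesTo_perspectiveExt hA hB).2
      (.of_forall fun k => ?_)
    refine StrongTendsto.le_of_forall_le (DecreasesTo.perspective_add_algebraMap
      hf.continuousOn hS0 hT0 hS hT Nat.one_div_pos_of_nat) (.of_forall fun n => ?_)
    exact (hW.le n).trans ((hf.decreasesTo_perspectiveExt (hS0 n) (hT0 n)).le k)
  rwa [le_antisymm h1 h2]

theorem eventually_le_add_epsOp {S : ℕ → H →L[ℂ] H} {T : H →L[ℂ] H}
    (h : Tendsto S atTop (𝓝 T)) (hS : ∀ n, IsSelfAdjoint (S n)) (hT : IsSelfAdjoint T) (j : ℕ) :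
    ∀ᶠ k in atTop, S k ≤ T + epsOp H j := by
  have h0 := (tendsto_iff_norm_sub_tendsto_zero.1 h).eventually_le_const
    (Nat.one_div_pos_of_nat (α := ℝ) (n := j))
  refine h0.mono fun k hk => ?_
  rw [← sub_le_iff_le_add']
  exact ((hS k).sub hT).le_algebraMap_norm_self.trans (algebraMap_mono _ hk)

/-- Congruence invariance needs invertible operators, so `A`, `B`, `C` are all perturbed by `epsOp H
k`. For fixed `j`, the perturbed conjugates are eventually below `C * A * C + epsOp H j` and `C * B
* C + epsOp H j`; then `k`, and afterwards `j`, tends to infinity. -/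
theorem IsMeanGenerator.transformer (hf : IsMeanGenerator H f) {A B C : H →L[ℂ] H}
    (hA : 0 ≤ A) (hB : 0 ≤ B) (hC : 0 ≤ C) :
    C * perspectiveExt f A B * C ≤ perspectiveExt f (C * A * C) (C * B * C) := by
  have hCC (k : ℕ) := isStrictlyPositive_add_epsOp hC k
  have hlimC : Tendsto (fun k => C + epsOp H k) atTop (𝓝 C) := by
    simpa using tendsto_epsOp.const_add C
  have hconj {D : H →L[ℂ] H} (hD : 0 ≤ D) (j : ℕ) : ∀ᶠ k in atTop,
      (C + epsOp H k) * (D + epsOp H k) * (C + epsOp H k) ≤ C * D * C + epsOp H j := by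
    refine eventually_le_add_epsOp ?_ (fun k => ?_) ?_ j
    · have hD' : Tendsto (fun k => D + epsOp H k) atTop (𝓝 D) := by
        simpa using tendsto_epsOp.const_add D
      exact (hlimC.mul hD').mul hlimC
    · exact (isStrictlyPositive_conj (isStrictlyPositive_add_epsOp hD k) (hCC k)).isSelfAdjoint
    · exact .of_nonneg (conjugate_nonneg_of_nonneg hD hC)
  refine StrongTendsto.le_of_forall_le (hf.decreasesTo_perspectiveExt
    (conjugate_nonneg_of_nonneg hA hC) (conjugate_nonneg_of_nonneg hB hC)).2
    (.of_forall fun j => ?_)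
  refine le_of_tendsto ((hlimC.mul_const (perspectiveExt f A B)).mul hlimC) ?_
  filter_upwards [hconj hA j, hconj hB j] with k hkA hkB
  have hA' := isStrictlyPositive_add_epsOp hA k
  have hB' := isStrictlyPositive_add_epsOp hB k
  calc (C + epsOp H k) * perspectiveExt f A B * (C + epsOp H k)
      ≤ (C + epsOp H k) * perspective f (A + epsOp H k) (B + epsOp H k) * (C + epsOp H k) :=
        conjugate_le_conjugate_of_nonneg ((hf.decreasesTo_perspectiveExt hA hB).le k)
          (hCC k).nonneg
    _ = perspective f ((C + epsOp H k) * (A + epsOp H k) * (C + epsOp H k))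
          ((C + epsOp H k) * (B + epsOp H k) * (C + epsOp H k)) :=
        (perspective_congruence hf.continuousOn hA' hB' (hCC k)).symm
    _ ≤ _ := perspective_mono hf.continuousOn hf.monotone hf.transpose_monotone
        (isStrictlyPositive_conj hA' (hCC k)) (isStrictlyPositive_conj hB' (hCC k)) hkA hkB

theorem IsMeanGenerator.isKuboAndoMean (hf : IsMeanGenerator H f) :
    IsKuboAndoMean (perspectiveExt (H := H) f) where
  nonneg _ _ hA hB := hf.perspectiveExt_nonneg hA hB
  mono _ _ _ _ hA hB hAC hBD := hf.perspectiveExt_mono hA hB hAC hBD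
  transformer _ _ _ hA hB hC := hf.transformer hA hB hC
  continuous_above _ _ _ _ hS0 hT0 hS hT := hf.decreasesTo_of_decreasesTo hS0 hT0 hS hT
  one_one := by
    rw [hf.perspectiveExt_eq isStrictlyPositive_one isStrictlyPositive_one, perspective_one_left,
      cfc_apply_one, hf.map_one, _root_.map_one]

theorem IsMeanGenerator.isOperatorMean (hf : IsMeanGenerator H f)
    {M : (H →L[ℂ] H) → (H →L[ℂ] H) → (H →L[ℂ] H)}
    (hM : ∀ A B : H →L[ℂ] H, IsStrictlyPositive A → IsStrictlyPositive B →
      M A B = perspective f A B) : IsOperatorMean M :=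
  ⟨perspectiveExt f, hf.isKuboAndoMean, fun A B hA hB => by
    rw [hM A B hA hB, hf.perspectiveExt_eq hA hB]⟩

theorem IsMeanGenerator.isRepresentingFunction (hf : IsMeanGenerator H f)
    {M : (H →L[ℂ] H) → (H →L[ℂ] H) → (H →L[ℂ] H)}
    (hM : ∀ A B : H →L[ℂ] H, IsStrictlyPositive A → IsStrictlyPositive B →
      M A B = perspective f A B) : IsRepresentingFunction M f :=
  ⟨hf.pos, hf.continuousOn, hf.monotone, hf.map_one, hM⟩

end KuboAndo

/-! ### Scalar functions given by averaged kernels, and their operator monotonicity. -/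

section Kernels

variable {μ : Measure ℝ} {k k' : ℝ → ℝ → ℝ}

theorem restrict_unitInterval (hμ : ∀ᵐ t ∂μ, t ∈ Icc (0 : ℝ) 1) : μ.restrict (Icc 0 1) = μ :=
  Measure.restrict_eq_self_of_ae_mem hμ

/-- The image of a measure under `t ↦ 1 - t`. -/
noncomputable def reflect (μ : Measure ℝ) : Measure ℝ := μ.map (MeasurableEquiv.subLeft (1 : ℝ))

theorem integral_reflect (F : ℝ → ℝ) : ∫ t, F t ∂(reflect μ) = ∫ t, F (1 - t) ∂μ :=
  integral_map_equiv _ _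

/-- The kernel `(1 ∇_t x)⁻¹`. -/
noncomputable def harmKernel (t x : ℝ) : ℝ := ((1 - t) * 1 + t * x)⁻¹

/-- The kernel `1 ♯_t x`. -/
noncomputable def powKernel (t x : ℝ) : ℝ := x ^ t

/-- The function `x ↦ (∫ (1 ∇_t x)⁻¹ dμ(t))⁻¹`. -/
noncomputable def harmFun (μ : Measure ℝ) (x : ℝ) : ℝ := (∫ t, harmKernel t x ∂μ)⁻¹

/-- The function `x ↦ ∫ 1 ♯_t x dμ(t)`. -/
noncomputable def powFun (μ : Measure ℝ) (x : ℝ) : ℝ := ∫ t, powKernel t x ∂μ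

/-- Pointwise, `x⁻¹ (1 - t + t / x)⁻¹ = ((1 - t) x + t)⁻¹`, the kernel at `1 - t`. -/
theorem transposeFun_harmFun {x : ℝ} (hx : 0 < x) :
    transposeFun (harmFun μ) x = harmFun (reflect μ) x := by
  rw [transposeFun, harmFun, harmFun, integral_reflect, ← inv_inv x, ← mul_inv, inv_inv,
    ← integral_const_mul]
  congr 2
  funext t
  rw [harmKernel, harmKernel, ← mul_inv]
  congr 1
  field_simp
  ring

theorem transposeFun_powFun {x : ℝ} (hx : 0 < x) :
    transposeFun (powFun μ) x = powFun (reflect μ) x := by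
  rw [transposeFun, powFun, powFun, integral_reflect, ← integral_const_mul]
  congr 1
  funext t
  rw [powKernel, powKernel, Real.inv_rpow hx.le, Real.rpow_sub hx, Real.rpow_one, div_eq_mul_inv]

theorem reflect_unitInterval (hμ : ∀ᵐ t ∂μ, t ∈ Icc (0 : ℝ) 1) :
    ∀ᵐ t ∂(reflect μ), t ∈ Icc (0 : ℝ) 1 := by
  refine (ae_map_iff (MeasurableEquiv.subLeft (1 : ℝ)).measurable.aemeasurable
    measurableSet_Icc).2 ?_
  refine hμ.mono fun t ht => ?_
  exact ⟨sub_nonneg.2 ht.2, sub_le_self _ ht.1⟩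

variable [IsProbabilityMeasure μ]

theorem continuousOn_kernel_left
    (hk : ContinuousOn (Function.uncurry k) (Icc (0 : ℝ) 1 ×ˢ Ioi (0 : ℝ))) {x : ℝ} (hx : 0 < x) :
    ContinuousOn (fun t => k t x) (Icc 0 1) :=
  hk.comp (by fun_prop : Continuous fun t : ℝ => (t, x)).continuousOn fun _ ht => ⟨ht, hx⟩

theorem integrable_of_continuousOn_unitInterval {E : Type*} [NormedAddCommGroup E]
    (hμ : ∀ᵐ t ∂μ, t ∈ Icc (0 : ℝ) 1) {F : ℝ → E} (hF : ContinuousOn F (Icc 0 1)) :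
    Integrable F μ := by
  have h := hF.integrableOn_compact (μ := μ) isCompact_Icc
  rwa [IntegrableOn, restrict_unitInterval hμ] at h

theorem integrable_kernel (hμ : ∀ᵐ t ∂μ, t ∈ Icc (0 : ℝ) 1)
    (hk : ContinuousOn (Function.uncurry k) (Icc (0 : ℝ) 1 ×ˢ Ioi (0 : ℝ))) {x : ℝ} (hx : 0 < x) :
    Integrable (fun t => k t x) μ :=
  integrable_of_continuousOn_unitInterval hμ (continuousOn_kernel_left hk hx)

theorem integral_kernel_pos (hμ : ∀ᵐ t ∂μ, t ∈ Icc (0 : ℝ) 1)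
    (hk : ContinuousOn (Function.uncurry k) (Icc (0 : ℝ) 1 ×ˢ Ioi (0 : ℝ)))
    (hpos : ∀ t ∈ Icc (0 : ℝ) 1, ∀ x, 0 < x → 0 < k t x) {x : ℝ} (hx : 0 < x) :
    0 < ∫ t, k t x ∂μ := by
  obtain ⟨s, hs, hmin⟩ := isCompact_Icc.exists_isMinOn (nonempty_Icc.2 zero_le_one)
    (continuousOn_kernel_left hk hx)
  calc 0 < k s x := hpos s hs x hx
    _ = ∫ _, k s x ∂μ := by simp
    _ ≤ ∫ t, k t x ∂μ := integral_mono_ae (integrable_const _) (integrable_kernel hμ hk hx)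
        (hμ.mono fun t ht => hmin ht)

theorem hasDerivAt_integral_kernel (hμ : ∀ᵐ t ∂μ, t ∈ Icc (0 : ℝ) 1)
    (hk : ContinuousOn (Function.uncurry k) (Icc (0 : ℝ) 1 ×ˢ Ioi (0 : ℝ)))
    (hk' : ContinuousOn (Function.uncurry k') (Icc (0 : ℝ) 1 ×ˢ Ioi (0 : ℝ)))
    (hd : ∀ t ∈ Icc (0 : ℝ) 1, ∀ x, 0 < x → HasDerivAt (k t) (k' t x) x) {x : ℝ} (hx : 0 < x) :
    HasDerivAt (fun y => ∫ t, k t y ∂μ) (∫ t, k' t x ∂μ) x := by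
  -- On this compact neighbourhood of `x`, inside the strip where `k'` is continuous, `k'` is
  -- bounded; the bound is the dominating constant.
  have hsub : Icc (0 : ℝ) 1 ×ˢ Icc (x / 2) (2 * x) ⊆ Icc (0 : ℝ) 1 ×ˢ Ioi (0 : ℝ) :=
    prod_mono le_rfl fun y hy => (half_pos hx).trans_le hy.1
  obtain ⟨C, hC⟩ := (isCompact_Icc.prod isCompact_Icc).exists_bound_of_continuousOn (hk'.mono hsub)
  refine (hasDerivAt_integral_of_dominated_loc_of_deriv_le (μ := μ) (F := fun y t => k t y)
    (F' := fun y t => k' t y) (s := Icc (x / 2) (2 * x)) (bound := fun _ => C)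
    (Icc_mem_nhds (by linarith) (by linarith)) ?_ (integrable_kernel hμ hk hx)
    (integrable_kernel hμ hk' hx).aestronglyMeasurable ?_ (integrable_const _) ?_).2
  · filter_upwards [Ioi_mem_nhds hx] with y hy
    exact (integrable_kernel hμ hk hy).aestronglyMeasurable
  · exact hμ.mono fun t ht y hy => hC (t, y) ⟨ht, hy⟩
  · exact hμ.mono fun t ht y hy => hd t ht y ((half_pos hx).trans_le hy.1)

variable {H : Type*} [NormedAddCommGroup H] [InnerProductSpace ℂ H] [CompleteSpace H]

/-- The kernel is bounded on the compact set `[0, 1] × spectrum`, so the functional calculus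
commutes with the integral over `[0, 1]`, which carries all of `μ`. -/
theorem integrable_cfc_kernel (hμ : ∀ᵐ t ∂μ, t ∈ Icc (0 : ℝ) 1)
    (hk : ContinuousOn (Function.uncurry k) (Icc (0 : ℝ) 1 ×ˢ Ioi (0 : ℝ))) {A : H →L[ℂ] H}
    (hA : IsStrictlyPositive A) :
    Integrable (fun t => cfc (k t) A) μ ∧
      cfc (fun x => ∫ t, k t x ∂μ) A = ∫ t, cfc (k t) A ∂μ := by
  have hc : ContinuousOn (Function.uncurry k) (Icc (0 : ℝ) 1 ×ˢ spectrum ℝ A) :=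
    hk.mono (prod_mono le_rfl (spectrum_subset_Ioi hA))
  obtain ⟨C, hC⟩ := (isCompact_Icc.prod
    (spectrum.isCompact (𝕜 := ℝ) A)).exists_bound_of_continuousOn hc
  have hb : ∀ᵐ t ∂(μ.restrict (Icc 0 1)), ∀ z ∈ spectrum ℝ A, ‖k t z‖ ≤ C :=
    ae_restrict_of_forall_mem measurableSet_Icc fun t ht z hz => hC (t, z) ⟨ht, hz⟩
  have h1 := integrableOn_cfc measurableSet_Icc k (fun _ => C) A hc hb
    (integrable_const (μ := μ.restrict (Icc 0 1)) C).hasFiniteIntegral hA.isSelfAdjoint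
  have h2 := cfc_setIntegral measurableSet_Icc k (fun _ => C) A hc hb
    (integrable_const (μ := μ.restrict (Icc 0 1)) C).hasFiniteIntegral hA.isSelfAdjoint
  rw [IntegrableOn, restrict_unitInterval hμ] at h1
  rw [restrict_unitInterval hμ] at h2
  exact ⟨h1, h2⟩

theorem cfc_integral_kernel_le (hμ : ∀ᵐ t ∂μ, t ∈ Icc (0 : ℝ) 1)
    (hk : ContinuousOn (Function.uncurry k) (Icc (0 : ℝ) 1 ×ˢ Ioi (0 : ℝ))) {A B : H →L[ℂ] H}
    (hA : IsStrictlyPositive A) (hB : IsStrictlyPositive B)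
    (h : ∀ t ∈ Icc (0 : ℝ) 1, cfc (k t) A ≤ cfc (k t) B) :
    cfc (fun x => ∫ t, k t x ∂μ) A ≤ cfc (fun x => ∫ t, k t x ∂μ) B := by
  rw [(integrable_cfc_kernel hμ hk hA).2, (integrable_cfc_kernel hμ hk hB).2]
  exact integral_mono_ae (integrable_cfc_kernel hμ hk hA).1 (integrable_cfc_kernel hμ hk hB).1
    (hμ.mono h)

theorem arith_pos {t x : ℝ} (ht : t ∈ Icc (0 : ℝ) 1) (hx : 0 < x) : 0 < (1 - t) * 1 + t * x := by
  rcases ht.1.eq_or_lt with rfl | h0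
  · simp
  · have := mul_pos h0 hx
    linarith [ht.2]

theorem harmKernel_pos {t : ℝ} (ht : t ∈ Icc (0 : ℝ) 1) (x : ℝ) (hx : 0 < x) :
    0 < harmKernel t x := inv_pos.2 (arith_pos ht hx)

theorem powKernel_pos (t x : ℝ) (hx : 0 < x) : 0 < powKernel t x := Real.rpow_pos_of_pos hx t

theorem continuousOn_harmKernel :
    ContinuousOn (Function.uncurry harmKernel) (Icc (0 : ℝ) 1 ×ˢ Ioi (0 : ℝ)) := by
  have : Continuous fun p : ℝ × ℝ => (1 - p.1) * 1 + p.1 * p.2 := by fun_prop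
  exact this.continuousOn.inv₀ fun p hp => (arith_pos hp.1 hp.2).ne'

theorem continuousOn_powKernel :
    ContinuousOn (Function.uncurry powKernel) (Icc (0 : ℝ) 1 ×ˢ Ioi (0 : ℝ)) :=
  continuousOn_snd.rpow continuousOn_fst fun _ hp => .inl (ne_of_gt hp.2)

theorem hasDerivAt_integral_harmKernel (hμ : ∀ᵐ t ∂μ, t ∈ Icc (0 : ℝ) 1) {x : ℝ} (hx : 0 < x) :
    HasDerivAt (fun y => ∫ t, harmKernel t y ∂μ)
      (∫ t, -t / ((1 - t) * 1 + t * x) ^ 2 ∂μ) x := by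
  refine hasDerivAt_integral_kernel (k' := fun t x => -t / ((1 - t) * 1 + t * x) ^ 2) hμ
    continuousOn_harmKernel ?_ (fun t ht x hx => ?_) hx
  · have h1 : Continuous fun p : ℝ × ℝ => -p.1 := by fun_prop
    have h2 : Continuous fun p : ℝ × ℝ => ((1 - p.1) * 1 + p.1 * p.2) ^ 2 := by fun_prop
    exact h1.continuousOn.div h2.continuousOn fun p hp => (pow_pos (arith_pos hp.1 hp.2) 2).ne'
  · have h : HasDerivAt (fun y => (1 - t) * 1 + t * y) t x := by
      simpa using ((hasDerivAt_id x).const_mul t).const_add ((1 - t) * 1)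
    exact h.inv (arith_pos ht hx).ne'

theorem hasDerivAt_integral_powKernel (hμ : ∀ᵐ t ∂μ, t ∈ Icc (0 : ℝ) 1) {x : ℝ} (hx : 0 < x) :
    HasDerivAt (fun y => ∫ t, powKernel t y ∂μ) (∫ t, t * x ^ (t - 1) ∂μ) x := by
  refine hasDerivAt_integral_kernel (k' := fun t x => t * x ^ (t - 1)) hμ
    continuousOn_powKernel ?_ (fun t ht x hx => ?_) hx
  · exact continuousOn_fst.mul (continuousOn_snd.rpow (continuousOn_fst.sub continuousOn_const)
      fun p hp => .inl (ne_of_gt hp.2))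
  · exact Real.hasDerivAt_rpow_const (.inl hx.ne')

theorem harmFun_pos (hμ : ∀ᵐ t ∂μ, t ∈ Icc (0 : ℝ) 1) {x : ℝ} (hx : 0 < x) : 0 < harmFun μ x :=
  inv_pos.2 (integral_kernel_pos hμ continuousOn_harmKernel (fun _ ht => harmKernel_pos ht) hx)

theorem powFun_pos (hμ : ∀ᵐ t ∂μ, t ∈ Icc (0 : ℝ) 1) {x : ℝ} (hx : 0 < x) : 0 < powFun μ x :=
  integral_kernel_pos hμ continuousOn_powKernel (fun _ _ => powKernel_pos _) hx

theorem continuousOn_harmFun (hμ : ∀ᵐ t ∂μ, t ∈ Icc (0 : ℝ) 1) :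
    ContinuousOn (harmFun μ) (Ioi 0) := fun _ hx =>
  ((hasDerivAt_integral_harmKernel hμ hx).continuousAt.inv₀
    (inv_pos.1 (harmFun_pos hμ hx)).ne').continuousWithinAt

theorem continuousOn_powFun (hμ : ∀ᵐ t ∂μ, t ∈ Icc (0 : ℝ) 1) :
    ContinuousOn (powFun μ) (Ioi 0) := fun _ hx =>
  (hasDerivAt_integral_powKernel hμ hx).continuousAt.continuousWithinAt

theorem harmFun_one : harmFun μ 1 = 1 := by simp [harmFun, harmKernel]

theorem powFun_one : powFun μ 1 = 1 := by simp [powFun, powKernel]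

/-- At `x = 1` the kernel is `1` and its derivative is `-t`; the outer inverse restores the sign. -/
theorem hasDerivAt_harmFun_one (hμ : ∀ᵐ t ∂μ, t ∈ Icc (0 : ℝ) 1) :
    HasDerivAt (harmFun μ) (∫ t, t ∂μ) 1 := by
  have h := (hasDerivAt_integral_harmKernel hμ one_pos).inv
    (inv_pos.1 (harmFun_pos hμ one_pos)).ne'
  have h1 : ∫ t, harmKernel t 1 ∂μ = 1 := by simp [harmKernel]
  have e : (-∫ t, -t / ((1 - t) * 1 + t * 1) ^ 2 ∂μ) / (∫ t, harmKernel t 1 ∂μ) ^ 2 =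
      ∫ t, t ∂μ := by
    rw [h1, ← integral_neg]
    simp
  rw [e] at h
  exact h

theorem hasDerivAt_powFun_one (hμ : ∀ᵐ t ∂μ, t ∈ Icc (0 : ℝ) 1) :
    HasDerivAt (powFun μ) (∫ t, t ∂μ) 1 := by
  have h := hasDerivAt_integral_powKernel hμ one_pos
  simp only [Real.one_rpow, mul_one] at h
  exact h

/-- Löwner–Heinz for each exponent in `[0, 1]`, then integration. -/
theorem operatorMonotoneOn_powFun (hμ : ∀ᵐ t ∂μ, t ∈ Icc (0 : ℝ) 1) :
    OperatorMonotoneOn H (powFun μ) (Ioi 0) := by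
  intro A B hA hB hsA hsB hAB
  have hA' := isStrictlyPositive_of_spectrum hA hsA
  have hB' := isStrictlyPositive_of_spectrum hB hsB
  refine cfc_integral_kernel_le hμ continuousOn_powKernel hA' hB' fun t ht => ?_
  have h := CFC.monotone_rpow ht hAB
  simp only [CFC.rpow_eq_cfc_real hA'.nonneg, CFC.rpow_eq_cfc_real hB'.nonneg] at h
  exact h

theorem isStrictlyPositive_arith {t : ℝ} (ht : t ∈ Icc (0 : ℝ) 1) {A B : H →L[ℂ] H}
    (hA : IsStrictlyPositive A) (hB : IsStrictlyPositive B) : IsStrictlyPositive (arith t A B) := by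
  rcases ht.1.eq_or_lt with rfl | h0
  · simpa [arith] using hA
  · exact (hB.smul h0).nonneg_add (smul_nonneg (sub_nonneg.2 ht.2) hA.nonneg)

theorem cfc_harmKernel {t : ℝ} (ht : t ∈ Icc (0 : ℝ) 1) {A : H →L[ℂ] H}
    (hA : IsStrictlyPositive A) : cfc (harmKernel t) A = Ring.inverse (arith t 1 A) := by
  have hsa := hA.isSelfAdjoint
  have e : cfc (fun x : ℝ => (1 - t) * 1 + t * x) A = arith t 1 A := by
    rw [cfc_const_add _ _ A, cfc_const_mul_id t A, arith, mul_one, Algebra.algebraMap_eq_smul_one]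
  rw [← e, ← cfc_inv (fun x : ℝ => (1 - t) * 1 + t * x) A
    fun x hx => (arith_pos ht (spectrum_subset_Ioi hA hx)).ne']
  rfl

theorem isStrictlyPositive_cfc_of_pos {f : ℝ → ℝ} (hf : ContinuousOn f (Ioi 0))
    (hpos : ∀ x, 0 < x → 0 < f x) {A : H →L[ℂ] H} (hA : IsStrictlyPositive A) :
    IsStrictlyPositive (cfc f A) := by
  refine isStrictlyPositive_of_spectrum (cfc_predicate f A) ?_
  rw [cfc_map_spectrum f A hA.isSelfAdjoint (hf.mono (spectrum_subset_Ioi hA))]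
  rintro _ ⟨x, hx, rfl⟩
  exact hpos x (spectrum_subset_Ioi hA hx)

theorem continuousOn_integral_harmKernel (hμ : ∀ᵐ t ∂μ, t ∈ Icc (0 : ℝ) 1) :
    ContinuousOn (fun x => ∫ t, harmKernel t x ∂μ) (Ioi 0) := fun _ hx =>
  (hasDerivAt_integral_harmKernel hμ hx).continuousAt.continuousWithinAt

theorem isStrictlyPositive_cfc_integral_harmKernel (hμ : ∀ᵐ t ∂μ, t ∈ Icc (0 : ℝ) 1)
    {A : H →L[ℂ] H} (hA : IsStrictlyPositive A) :
    IsStrictlyPositive (cfc (fun x => ∫ t, harmKernel t x ∂μ) A) :=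
  isStrictlyPositive_cfc_of_pos (continuousOn_integral_harmKernel hμ)
    (fun _ hx => inv_pos.1 (harmFun_pos hμ hx)) hA

theorem cfc_harmFun (hμ : ∀ᵐ t ∂μ, t ∈ Icc (0 : ℝ) 1) {A : H →L[ℂ] H}
    (hA : IsStrictlyPositive A) :
    cfc (harmFun μ) A = Ring.inverse (cfc (fun x => ∫ t, harmKernel t x ∂μ) A) := by
  rw [← cfc_inv (fun x => ∫ t, harmKernel t x ∂μ) A
    (fun x hx => (inv_pos.1 (harmFun_pos hμ (spectrum_subset_Ioi hA hx))).ne')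
    ((continuousOn_integral_harmKernel hμ).mono (spectrum_subset_Ioi hA)) hA.isSelfAdjoint]
  rfl

/-- Inversion reverses the order twice: once inside the integral for each `t`, once outside. -/
theorem operatorMonotoneOn_harmFun (hμ : ∀ᵐ t ∂μ, t ∈ Icc (0 : ℝ) 1) :
    OperatorMonotoneOn H (harmFun μ) (Ioi 0) := by
  intro A B hA hB hsA hsB hAB
  have hA' := isStrictlyPositive_of_spectrum hA hsA
  have hB' := isStrictlyPositive_of_spectrum hB hsB
  rw [cfc_harmFun hμ hA', cfc_harmFun hμ hB']
  refine CStarAlgebra.ringInverse_le_ringInverse ?_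
    (isStrictlyPositive_cfc_integral_harmKernel hμ hB')
  refine cfc_integral_kernel_le hμ continuousOn_harmKernel hB' hA' fun t ht => ?_
  rw [cfc_harmKernel ht hA', cfc_harmKernel ht hB']
  refine CStarAlgebra.ringInverse_le_ringInverse ?_
    (isStrictlyPositive_arith ht isStrictlyPositive_one hA')
  exact add_le_add_right (smul_le_smul_of_nonneg_left hAB ht.1) _

instance : IsProbabilityMeasure (reflect μ) :=
  Measure.isProbabilityMeasure_map (MeasurableEquiv.subLeft (1 : ℝ)).measurable.aemeasurable

theorem OperatorMonotoneOn.congr {f g : ℝ → ℝ} {I : Set ℝ} (hf : OperatorMonotoneOn H f I)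
    (h : EqOn g f I) : OperatorMonotoneOn H g I := by
  intro A B hA hB hsA hsB hAB
  rw [cfc_congr (h.mono hsA), cfc_congr (h.mono hsB)]
  exact hf A B hA hB hsA hsB hAB

theorem isMeanGenerator_harmFun (hμ : ∀ᵐ t ∂μ, t ∈ Icc (0 : ℝ) 1) :
    IsMeanGenerator H (harmFun μ) where
  pos _ hx := harmFun_pos hμ hx
  continuousOn := continuousOn_harmFun hμ
  monotone := operatorMonotoneOn_harmFun hμ
  transpose_monotone := (operatorMonotoneOn_harmFun (reflect_unitInterval hμ)).congr
    fun _ hx => transposeFun_harmFun hx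
  map_one := harmFun_one

theorem isMeanGenerator_powFun (hμ : ∀ᵐ t ∂μ, t ∈ Icc (0 : ℝ) 1) :
    IsMeanGenerator H (powFun μ) where
  pos _ hx := powFun_pos hμ hx
  continuousOn := continuousOn_powFun hμ
  monotone := operatorMonotoneOn_powFun hμ
  transpose_monotone := (operatorMonotoneOn_powFun (reflect_unitInterval hμ)).congr
    fun _ hx => transposeFun_powFun hx
  map_one := powFun_one

end Kernels

/-! ### The operator integrals as perspectives. -/

section Means

variable {μ : Measure ℝ} [IsProbabilityMeasure μ]
variable {H : Type*} [NormedAddCommGroup H] [InnerProductSpace ℂ H]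

theorem ringInverse_eq_of_mul_eq_one {a b : H →L[ℂ] H} (h1 : a * b = 1) (h2 : b * a = 1) :
    Ring.inverse a = b :=
  Ring.inverse_unit ⟨a, b, h1, h2⟩

theorem ringInverse_conj {P Q X : H →L[ℂ] H} (hPQ : P * Q = 1) (hQP : Q * P = 1)
    (hX : IsUnit X) : Ring.inverse (P * X * P) = Q * Ring.inverse X * Q := by
  refine ringInverse_eq_of_mul_eq_one ?_ ?_
  · calc P * X * P * (Q * Ring.inverse X * Q) = P * (X * (P * Q) * Ring.inverse X) * Q := by
          noncomm_ring
      _ = 1 := by rw [hPQ, mul_one, Ring.mul_inverse_cancel X hX, mul_one, hPQ]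
  · calc Q * Ring.inverse X * Q * (P * X * P) = Q * (Ring.inverse X * (Q * P) * X) * P := by
          noncomm_ring
      _ = 1 := by rw [hQP, mul_one, Ring.inverse_mul_cancel X hX, mul_one, hQP]

variable [CompleteSpace H]

/-- `A ∇_t B = A^{1/2} (1 ∇_t D) A^{1/2}` with `D = A^{-1/2} B A^{-1/2}`; inverting leaves outer
factors independent of `t`, which can leave the integral. -/
theorem ringInverse_arith {t : ℝ} (ht : t ∈ Icc (0 : ℝ) 1) {A B : H →L[ℂ] H}
    (hA : IsStrictlyPositive A) (hB : IsStrictlyPositive B) :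
    Ring.inverse (arith t A B) = A ^ (-(1 / 2) : ℝ) *
      cfc (harmKernel t) (A ^ (-(1 / 2) : ℝ) * B * A ^ (-(1 / 2) : ℝ)) * A ^ (-(1 / 2) : ℝ) := by
  have hD := isStrictlyPositive_conj_rpow_neg_half hA hB
  have hPQ := rpow_half_mul_neg_half hA
  have hQP := rpow_neg_half_mul_half hA
  have hPP := rpow_half_mul_self hA
  rw [cfc_harmKernel ht hD, ← ringInverse_conj hPQ hQP
    (isStrictlyPositive_arith ht isStrictlyPositive_one hD).isUnit]
  congr 1
  set P := A ^ (1 / 2 : ℝ)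
  set Q := A ^ (-(1 / 2) : ℝ)
  have e : P * (Q * B * Q) * P = B := by
    calc P * (Q * B * Q) * P = (P * Q) * B * (Q * P) := by noncomm_ring
      _ = B := by rw [hPQ, hQP, one_mul, mul_one]
  simp only [arith, mul_add, add_mul, mul_smul_comm, smul_mul_assoc, mul_one, e, hPP]

theorem integrable_ringInverse_arith (hμ : ∀ᵐ t ∂μ, t ∈ Icc (0 : ℝ) 1) {A B : H →L[ℂ] H}
    (hA : IsStrictlyPositive A) (hB : IsStrictlyPositive B) :
    Integrable (fun t => Ring.inverse (arith t A B)) μ :=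
  (((integrable_cfc_kernel hμ continuousOn_harmKernel
    (isStrictlyPositive_conj_rpow_neg_half hA hB)).1.const_mul _).mul_const _).congr
    (hμ.mono fun _ ht => (ringInverse_arith ht hA hB).symm)

theorem integral_ringInverse_arith (hμ : ∀ᵐ t ∂μ, t ∈ Icc (0 : ℝ) 1) {A B : H →L[ℂ] H}
    (hA : IsStrictlyPositive A) (hB : IsStrictlyPositive B) :
    ∫ t, Ring.inverse (arith t A B) ∂μ = A ^ (-(1 / 2) : ℝ) *
      cfc (fun x => ∫ t, harmKernel t x ∂μ) (A ^ (-(1 / 2) : ℝ) * B * A ^ (-(1 / 2) : ℝ)) *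
        A ^ (-(1 / 2) : ℝ) := by
  obtain ⟨h1, h2⟩ := integrable_cfc_kernel hμ continuousOn_harmKernel
    (isStrictlyPositive_conj_rpow_neg_half hA hB)
  rw [integral_congr_ae (hμ.mono fun _ ht => ringInverse_arith ht hA hB),
    integral_mul_const_of_integrable (h1.const_mul _), integral_const_mul_of_integrable h1, h2]

theorem isUnit_integral_ringInverse_arith (hμ : ∀ᵐ t ∂μ, t ∈ Icc (0 : ℝ) 1) {A B : H →L[ℂ] H}
    (hA : IsStrictlyPositive A) (hB : IsStrictlyPositive B) :
    IsUnit (∫ t, Ring.inverse (arith t A B) ∂μ) := by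
  rw [integral_ringInverse_arith hμ hA hB]
  exact (isStrictlyPositive_conj (isStrictlyPositive_cfc_integral_harmKernel hμ
    (isStrictlyPositive_conj_rpow_neg_half hA hB)) (hA.rpow A _)).isUnit

theorem ringInverse_integral_ringInverse_arith (hμ : ∀ᵐ t ∂μ, t ∈ Icc (0 : ℝ) 1)
    {A B : H →L[ℂ] H} (hA : IsStrictlyPositive A) (hB : IsStrictlyPositive B) :
    Ring.inverse (∫ t, Ring.inverse (arith t A B) ∂μ) = perspective (harmFun μ) A B := by
  have hD := isStrictlyPositive_conj_rpow_neg_half hA hB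
  rw [integral_ringInverse_arith hμ hA hB, ringInverse_conj (rpow_neg_half_mul_half hA)
    (rpow_half_mul_neg_half hA) (isStrictlyPositive_cfc_integral_harmKernel hμ hD).isUnit,
    perspective, cfc_harmFun hμ hD]

theorem geom_eq_perspective (t : ℝ) {A B : H →L[ℂ] H} (hA : IsStrictlyPositive A)
    (hB : IsStrictlyPositive B) : geom t A B = perspective (powKernel t) A B := by
  rw [geom, perspective,
    CFC.rpow_eq_cfc_real (y := t) (isStrictlyPositive_conj_rpow_neg_half hA hB).nonneg]
  rfl

theorem integrable_geom (hμ : ∀ᵐ t ∂μ, t ∈ Icc (0 : ℝ) 1) {A B : H →L[ℂ] H}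
    (hA : IsStrictlyPositive A) (hB : IsStrictlyPositive B) :
    Integrable (fun t => geom t A B) μ :=
  (((integrable_cfc_kernel hμ continuousOn_powKernel
    (isStrictlyPositive_conj_rpow_neg_half hA hB)).1.const_mul _).mul_const _).congr
    (.of_forall fun t => (geom_eq_perspective t hA hB).symm)

theorem integral_geom (hμ : ∀ᵐ t ∂μ, t ∈ Icc (0 : ℝ) 1) {A B : H →L[ℂ] H}
    (hA : IsStrictlyPositive A) (hB : IsStrictlyPositive B) :
    ∫ t, geom t A B ∂μ = perspective (powFun μ) A B := by
  obtain ⟨h1, h2⟩ := integrable_cfc_kernel hμ continuousOn_powKernel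
    (isStrictlyPositive_conj_rpow_neg_half hA hB)
  rw [integral_congr_ae (.of_forall fun t => geom_eq_perspective t hA hB)]
  simp only [perspective]
  rw [integral_mul_const_of_integrable (h1.const_mul _), integral_const_mul_of_integrable h1, ← h2]
  rfl

end Means

/-! ### The measures `η_l`: total mass, mean, and the case `l = 1/2`. -/

section Eta

theorem eta_of_mem_Ioo {l : ℝ} (hl : l ∈ Ioo (0 : ℝ) 1) :
    eta l = (volume.restrict (Icc (0 : ℝ) 1)).withDensity
      (fun t => ENNReal.ofReal (l / (1 - l) * t ^ ((2 * l - 1) / (1 - l)))) := by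
  rw [eta, if_neg hl.1.ne', if_neg hl.2.ne]

theorem eta_unitInterval (l : ℝ) (hl : l ∈ Icc (0 : ℝ) 1) : ∀ᵐ t ∂(eta l), t ∈ Icc (0 : ℝ) 1 := by
  rcases hl.1.eq_or_lt with rfl | h0
  · rw [eta, if_pos rfl, ae_dirac_eq]
    simp
  rcases hl.2.eq_or_lt with rfl | h1
  · rw [eta, if_neg one_ne_zero, if_pos rfl, ae_dirac_eq]
    simp
  rw [eta_of_mem_Ioo ⟨h0, h1⟩]
  exact (withDensity_absolutelyContinuous _ _).ae_le (ae_restrict_mem measurableSet_Icc)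

theorem etaDensity_nonneg {l : ℝ} (hl : l ∈ Ioo (0 : ℝ) 1) {t : ℝ} (ht : 0 ≤ t) :
    0 ≤ l / (1 - l) * t ^ ((2 * l - 1) / (1 - l)) :=
  mul_nonneg (div_nonneg hl.1.le (sub_nonneg.2 hl.2.le)) (Real.rpow_nonneg ht _)

/-- Integrability of the density at `0`; the condition amounts to `0 < l`. -/
theorem eta_exponent_gt {l : ℝ} (hl : l ∈ Ioo (0 : ℝ) 1) : -1 < (2 * l - 1) / (1 - l) := by
  rw [lt_div_iff₀ (sub_pos.2 hl.2)]
  linarith [hl.1]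

theorem isProbabilityMeasure_eta (l : ℝ) (hl : l ∈ Icc (0 : ℝ) 1) :
    IsProbabilityMeasure (eta l) := by
  rcases hl.1.eq_or_lt with rfl | h0
  · rw [eta, if_pos rfl]
    infer_instance
  rcases hl.2.eq_or_lt with rfl | h1
  · rw [eta, if_neg one_ne_zero, if_pos rfl]
    infer_instance
  have hl' : l ∈ Ioo (0 : ℝ) 1 := ⟨h0, h1⟩
  have h1l : 1 - l ≠ 0 := (sub_pos.2 h1).ne'
  refine ⟨?_⟩
  rw [eta_of_mem_Ioo hl', withDensity_apply _ .univ, Measure.restrict_univ,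
    ← ofReal_integral_eq_lintegral_ofReal]
  · rw [integral_Icc_eq_integral_Ioc, ← intervalIntegral.integral_of_le zero_le_one,
      intervalIntegral.integral_const_mul, integral_rpow (.inl (eta_exponent_gt hl')),
      Real.one_rpow, Real.zero_rpow (by linarith [eta_exponent_gt hl'])]
    have : (2 * l - 1) / (1 - l) + 1 = l / (1 - l) := by field_simp; ring
    rw [this, sub_zero, mul_one_div_cancel (div_pos h0 (sub_pos.2 h1)).ne', ENNReal.ofReal_one]
  · rw [← IntegrableOn, integrableOn_Icc_iff_integrableOn_Ioc,
      ← intervalIntegrable_iff_integrableOn_Ioc_of_le zero_le_one]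
    exact (intervalIntegral.intervalIntegrable_rpow' (eta_exponent_gt hl')).const_mul _
  · exact ae_restrict_of_forall_mem measurableSet_Icc fun t ht => etaDensity_nonneg hl' ht.1

/-- With `c = l / (1 - l)` the integral is `∫ c t^c dt = c / (c + 1) = l`. -/
theorem integral_id_eta (l : ℝ) (hl : l ∈ Icc (0 : ℝ) 1) : ∫ t, t ∂(eta l) = l := by
  rcases hl.1.eq_or_lt with rfl | h0
  · rw [eta, if_pos rfl, integral_dirac]
  rcases hl.2.eq_or_lt with rfl | h1
  · rw [eta, if_neg one_ne_zero, if_pos rfl, integral_dirac]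
  have hl' : l ∈ Ioo (0 : ℝ) 1 := ⟨h0, h1⟩
  have h1l : 0 < 1 - l := sub_pos.2 h1
  rw [eta_of_mem_Ioo hl', integral_withDensity_eq_integral_toReal_smul (by fun_prop)
    (.of_forall fun _ => ENNReal.ofReal_lt_top)]
  -- The point `0` is left out because adding exponents of `t` needs `t ≠ 0`.
  have e : ∀ t ∈ Ioc (0 : ℝ) 1,
      (ENNReal.ofReal (l / (1 - l) * t ^ ((2 * l - 1) / (1 - l)))).toReal • t =
        l / (1 - l) * t ^ (l / (1 - l)) := by
    intro t ht
    rw [ENNReal.toReal_ofReal (etaDensity_nonneg hl' ht.1.le), smul_eq_mul, mul_assoc,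
      ← Real.rpow_add_one ht.1.ne']
    congr 2
    field_simp
    ring
  rw [integral_Icc_eq_integral_Ioc, setIntegral_congr_fun measurableSet_Ioc e,
    ← intervalIntegral.integral_of_le zero_le_one, intervalIntegral.integral_const_mul,
    integral_rpow (.inl (by have := div_pos h0 h1l; linarith)), Real.one_rpow,
    Real.zero_rpow (by have := div_pos h0 h1l; linarith)]
  field_simp
  ring

theorem eta_half : eta (1 / 2) = volume.restrict (Icc (0 : ℝ) 1) := by
  rw [eta_of_mem_Ioo ⟨by norm_num, by norm_num⟩]
  norm_num

/-- Both sides are the scalar logarithmic mean `(x - 1) / log x`; `x = 1` is separate because the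
antiderivatives divide by `x - 1` and `log x`. -/
theorem fRep_half_eq_gRep_half {x : ℝ} (hx : 0 < x) : fRep (1 / 2) x = gRep (1 / 2) x := by
  rcases eq_or_ne x 1 with rfl | hx1
  · rw [fRep, gRep, eta_half]
    simp
  have hlog : Real.log x ≠ 0 := (Real.log_ne_zero_of_pos_of_ne_one hx hx1)
  have hx1' : x - 1 ≠ 0 := sub_ne_zero.2 hx1
  have hIcc {t : ℝ} (ht : t ∈ uIcc (0 : ℝ) 1) : t ∈ Icc (0 : ℝ) 1 := by
    rwa [uIcc_of_le zero_le_one] at ht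
  have hf : ∫ t in (0 : ℝ)..1, ((1 - t) * 1 + t * x)⁻¹ = Real.log x / (x - 1) := by
    rw [intervalIntegral.integral_eq_sub_of_hasDerivAt
      (f := fun t => Real.log ((1 - t) * 1 + t * x) / (x - 1))]
    · simp
    · intro t ht
      have hp := arith_pos (hIcc ht) hx
      have h : HasDerivAt (fun t : ℝ => (1 - t) * 1 + t * x) (x - 1) t := by
        have h1 := (((hasDerivAt_id t).const_sub 1).mul_const 1).add
          ((hasDerivAt_id t).mul_const x)
        exact h1.congr_deriv (by ring)
      exact ((h.log hp.ne').div_const (x - 1)).congr_deriv (by field_simp)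
    · refine ContinuousOn.intervalIntegrable ?_
      have : Continuous fun t : ℝ => (1 - t) * 1 + t * x := by fun_prop
      exact this.continuousOn.inv₀ fun t ht => (arith_pos (hIcc ht) hx).ne'
  have hg : ∫ t in (0 : ℝ)..1, x ^ t = (x - 1) / Real.log x := by
    rw [intervalIntegral.integral_eq_sub_of_hasDerivAt (f := fun t => x ^ t / Real.log x)]
    · rw [Real.rpow_one, Real.rpow_zero, ← sub_div]
    · intro t _
      exact ((Real.hasStrictDerivAt_const_rpow hx t).hasDerivAt.div_const _).congr_deriv
        (mul_div_cancel_right₀ _ hlog)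
    · exact (Real.continuous_const_rpow hx.ne').intervalIntegrable _ _
  rw [fRep, gRep, eta_half, integral_Icc_eq_integral_Ioc, integral_Icc_eq_integral_Ioc,
    ← intervalIntegral.integral_of_le zero_le_one, ← intervalIntegral.integral_of_le zero_le_one,
    hf, hg, inv_div]

variable {H : Type*} [NormedAddCommGroup H] [InnerProductSpace ℂ H]

/-- The integrands coincide: the double inverses in `A⁻¹ !_t B⁻¹` cancel, leaving `(A ∇_t B)⁻¹`. -/
theorem boldL_half_eq_logMean (A B : H →L[ℂ] H) (hA : IsStrictlyPositive A)
    (hB : IsStrictlyPositive B) : boldL (1 / 2) A B = logMean A B := by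
  rw [boldL, logMean, eta_half, integral_Icc_eq_integral_Ioc,
    intervalIntegral.integral_of_le zero_le_one]
  simp only [harm, arith, Ring.inverse_inverse hA.isUnit, Ring.inverse_inverse hB.isUnit]

end Eta

end WeightedLogMean

/-! ### Assembly of the proposition. -/

theorem mainTheorem5 {H : Type*} [NormedAddCommGroup H] [InnerProductSpace ℂ H] [CompleteSpace H] :
    (∀ l : ℝ, l ∈ Set.Icc (0 : ℝ) 1 →
      -- the integrals exist, and the outer inverse is that of an invertible operator
      (∀ A B : H →L[ℂ] H, IsStrictlyPositive A → IsStrictlyPositive B →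
        MeasureTheory.Integrable (fun t => Ring.inverse (WeightedLogMean.arith t A B))
          (WeightedLogMean.eta l) ∧
        IsUnit (∫ t, Ring.inverse (WeightedLogMean.arith t A B) ∂(WeightedLogMean.eta l)) ∧
        MeasureTheory.Integrable (fun t => WeightedLogMean.geom t A B)
          (WeightedLogMean.eta l)) ∧
      -- both are weighted operator means
      WeightedLogMean.IsWeightedOperatorMean (H := H) l (WeightedLogMean.boldL l) ∧
      WeightedLogMean.IsWeightedOperatorMean (H := H) l (WeightedLogMean.bbL l) ∧
      -- with these representing functions
      WeightedLogMean.IsRepresentingFunction (H := H) (WeightedLogMean.boldL l)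
        (WeightedLogMean.fRep l) ∧
      WeightedLogMean.IsRepresentingFunction (H := H) (WeightedLogMean.bbL l)
        (WeightedLogMean.gRep l) ∧
      -- which have the following properties
      WeightedLogMean.OperatorMonotoneOn H (WeightedLogMean.fRep l) (Set.Ioi 0) ∧
      WeightedLogMean.OperatorMonotoneOn H (WeightedLogMean.gRep l) (Set.Ioi 0) ∧
      WeightedLogMean.fRep l 1 = 1 ∧ WeightedLogMean.gRep l 1 = 1 ∧
      HasDerivAt (WeightedLogMean.fRep l) l 1 ∧ HasDerivAt (WeightedLogMean.gRep l) l 1) ∧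
    (∀ A B : H →L[ℂ] H, IsStrictlyPositive A → IsStrictlyPositive B →
      WeightedLogMean.boldL (1 / 2) A B = WeightedLogMean.logMean A B ∧
      WeightedLogMean.bbL (1 / 2) A B = WeightedLogMean.logMean A B) := by
  refine ⟨fun l hl => ?_, fun A B hA hB => ?_⟩
  · have hp := WeightedLogMean.isProbabilityMeasure_eta l hl
    have hμ := WeightedLogMean.eta_unitInterval l hl
    have hF := WeightedLogMean.isMeanGenerator_harmFun (H := H) hμ
    have hG := WeightedLogMean.isMeanGenerator_powFun (H := H) hμ
    have hdF := WeightedLogMean.hasDerivAt_harmFun_one hμ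
    have hdG := WeightedLogMean.hasDerivAt_powFun_one hμ
    rw [WeightedLogMean.integral_id_eta l hl] at hdF hdG
    have hMF (A B : H →L[ℂ] H) (hA : IsStrictlyPositive A) (hB : IsStrictlyPositive B) :=
      WeightedLogMean.ringInverse_integral_ringInverse_arith hμ hA hB
    have hMG (A B : H →L[ℂ] H) (hA : IsStrictlyPositive A) (hB : IsStrictlyPositive B) :=
      WeightedLogMean.integral_geom hμ hA hB
    have hrF := hF.isRepresentingFunction hMF
    have hrG := hG.isRepresentingFunction hMG
    -- `fRep l` and `gRep l` agree by definition with `harmFun (eta l)` and `powFun (eta l)`.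
    exact ⟨fun A B hA hB => ⟨WeightedLogMean.integrable_ringInverse_arith hμ hA hB,
        WeightedLogMean.isUnit_integral_ringInverse_arith hμ hA hB,
        WeightedLogMean.integrable_geom hμ hA hB⟩,
      ⟨hF.isOperatorMean hMF, _, hrF, hdF⟩, ⟨hG.isOperatorMean hMG, _, hrG, hdG⟩, hrF, hrG,
      hF.monotone, hG.monotone, hF.map_one, hG.map_one, hdF, hdG⟩
  · have hl : (1 / 2 : ℝ) ∈ Set.Icc (0 : ℝ) 1 := ⟨by norm_num, by norm_num⟩
    have hp := WeightedLogMean.isProbabilityMeasure_eta _ hl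
    have hμ := WeightedLogMean.eta_unitInterval _ hl
    have h := WeightedLogMean.boldL_half_eq_logMean A B hA hB
    refine ⟨h, ?_⟩
    rw [← h]
    refine (WeightedLogMean.integral_geom hμ hA hB).trans
      (Eq.trans ?_ (WeightedLogMean.ringInverse_integral_ringInverse_arith hμ hA hB).symm)
    -- Both means are perspectives of functions that agree on `(0, ∞)`, which contains the spectrum.
    have hc : cfc (WeightedLogMean.powFun (WeightedLogMean.eta (1 / 2)))
        (A ^ (-(1 / 2) : ℝ) * B * A ^ (-(1 / 2) : ℝ)) =
        cfc (WeightedLogMean.harmFun (WeightedLogMean.eta (1 / 2)))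
          (A ^ (-(1 / 2) : ℝ) * B * A ^ (-(1 / 2) : ℝ)) := cfc_congr fun x hx =>
      (WeightedLogMean.fRep_half_eq_gRep_half (WeightedLogMean.spectrum_subset_Ioi
        (WeightedLogMean.isStrictlyPositive_conj_rpow_neg_half hA hB) hx)).symm
    rw [WeightedLogMean.perspective, WeightedLogMean.perspective, hc]
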